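/- Let $m\ge 1$, let $(N,d\sigma^2)$ be a smooth Riemannian manifold of dimension $m-1$ (without boundary), let $t>0$, and let $\rho:[0,t]\to\mathbb{R}$ be smooth and nowhere zero. Let $Z=[0,t]\times N$ with the warped product metric $g=du^2+\rho(u)^2\,d\sigma^2$, let $\nabla^g$ be its Levi-Civita connection, and let $(V,\langle\cdot,\cdot\rangle,\nabla^Z,\gamma)$ be a (real or complex) Dirac bundle over $(Z,g)$: $V$ is a smooth vector bundle of finite rank with a Riemannian (Hermitian) structure $\langle\cdot,\cdot\rangle$, $\gamma$ is a Clifford multiplication, $\gamma(v)^2=-g(v,v)$, by skew-adjoint endomorphisms, and $\nabla^Z$ is a metric connection with $\nabla^Z_X(\gamma(Y)\varphi)=\gamma(\nabla^g_XY)\varphi+\gamma(Y)\nabla^Z_X\varphi$. The Dirac operator is $Q^Z=\sum_i\gamma(e_i)\nabla^Z_{e_i}$ for orthonormal frames $(e_i)$, and $P^Z=(Q^Z)^2$ is the Dirac Laplacian. For $u\in[0,t]$ let $N_u=\{u\}\times N$, with the induced metric $\rho(u)^2d\sigma^2$ and unit normal $\nu=\partial_u$, carry the induced Dirac bundle structure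 on $V|_{N_u}$, that is, the restriction of $\langle\cdot,\cdot\rangle$, the Clifford multiplication $\gamma_N(X)=-\gamma(\nu)\gamma(X)$, and the connection $$\nabla^{N}_X\varphi=\nabla^Z_X\varphi-\tfrac12\gamma(\nu)\gamma(\nabla^g_X\nu)\varphi\qquad(X\in TN_u).$$ Let $Q^N=Q^{N_u}$ be the Dirac operator of this Dirac bundle on $N_u$ and $P^N=(Q^{N_u})^2$ its Dirac Laplacian; they act on sections over $Z$ slice by slice. Let $H=-\rho'/\rho$ be the mean curvature of $N_u$ in $Z$. Then, for every smooth section $\sigma$ of $V$ over $Z$, $$P^Z\sigma=P^N\sigma+[Q^N,\nabla^Z_{\partial_u}]\sigma+\Bigl(\tfrac{m-1}{2}H'-\bigl(\tfrac{m-1}{2}\bigr)^2H^2\Bigr)\sigma+(m-1)H\,\nabla^Z_{\partial_u}\sigma-(\nabla^Z_{\partial_u})^2\sigma .$$ -/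

import Mathlib

open Bundle Set Module
open scoped Manifold ContDiff Topology

noncomputable section

namespace DiracGeometry

/-! ### Riemannian metrics and the Levi-Civita connection -/

section Riemannian

variable {E : Type*} [NormedAddCommGroup E] [NormedSpace ℝ E]
  {H : Type*} [TopologicalSpace H] {I : ModelWithCorners ℝ E H}
  {M : Type*} [TopologicalSpace M] [ChartedSpace H M] [IsManifold I ∞ M]

variable (I M) in
/-- Smooth Riemannian metrics on the manifold `M`. -/
abbrev SmoothMetric : Type _ :=
  ContMDiffRiemannianMetric I ∞ E (fun x : M ↦ TangentSpace I x)

/-- The metric at the point `x` as a bilinear form on the tangent space. -/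
def bilinForm (g : SmoothMetric I M) (x : M) : LinearMap.BilinForm ℝ (TangentSpace I x) :=
  LinearMap.mk₂ ℝ (fun v w ↦ g.inner x v w) (by simp) (by simp) (by simp) (by simp)

theorem bilinForm_nondegenerate (g : SmoothMetric I M) (x : M) :
    (bilinForm g x).Nondegenerate := by
  refine ⟨fun v hv ↦ ?_, fun v hv ↦ ?_⟩ <;>
  · by_contra h
    exact (g.pos x v h).ne' (hv v)

/-- The right-hand side of the Koszul formula for `2 g(∇_X Y, Z)` at `x`. -/
def koszul (g : SmoothMetric I M) (X Y Z : Π x : M, TangentSpace I x) (x : M) : ℝ :=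
  mvfderiv I (fun y ↦ g.inner y (Y y) (Z y)) x (X x)
    + mvfderiv I (fun y ↦ g.inner y (X y) (Z y)) x (Y x)
    - mvfderiv I (fun y ↦ g.inner y (X y) (Y y)) x (Z x)
    + g.inner x (VectorField.mlieBracket I X Y x) (Z x)
    - g.inner x (VectorField.mlieBracket I X Z x) (Y x)
    - g.inner x (VectorField.mlieBracket I Y Z x) (X x)

/-- The Levi-Civita connection `∇^g` of the metric `g`: `leviCivita g Y x X₀` is the covariant
derivative at `x` of the vector field `Y` in the direction `X₀`. It is the solution of the Koszul
formula `2 g(∇_X Y, Z) = koszul g X Y Z`. As the right-hand side at `x` depends on `X` and `Z`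
only through `X x` and `Z x`, it is enough to write the formula for one smooth extension of each
tangent vector at `x`; see `two_inner_leviCivita`. -/
def leviCivita (g : SmoothMetric I M) (Y : Π x : M, TangentSpace I x) (x : M) :
    TangentSpace I x →L[ℝ] TangentSpace I x :=
  Classical.epsilon fun A : TangentSpace I x →L[ℝ] TangentSpace I x ↦
    ∀ X₀ Z₀ : TangentSpace I x, 2 * g.inner x (A X₀) Z₀ =
      koszul g (FiberBundle.extend E X₀) Y (FiberBundle.extend E Z₀) x

/-- A solution of the Koszul formula is unique. -/
theorem leviCivita_eq (g : SmoothMetric I M) (Y : Π x : M, TangentSpace I x) (x : M)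
    (A : TangentSpace I x →L[ℝ] TangentSpace I x)
    (hA : ∀ X₀ Z₀ : TangentSpace I x, 2 * g.inner x (A X₀) Z₀ =
      koszul g (FiberBundle.extend E X₀) Y (FiberBundle.extend E Z₀) x) :
    leviCivita g Y x = A := by
  have hL : ∀ X₀ Z₀ : TangentSpace I x, 2 * g.inner x (leviCivita g Y x X₀) Z₀ =
      koszul g (FiberBundle.extend E X₀) Y (FiberBundle.extend E Z₀) x :=
    Classical.epsilon_spec (p := fun A : TangentSpace I x →L[ℝ] TangentSpace I x ↦
      ∀ X₀ Z₀ : TangentSpace I x, 2 * g.inner x (A X₀) Z₀ =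
        koszul g (FiberBundle.extend E X₀) Y (FiberBundle.extend E Z₀) x) ⟨A, hA⟩
  ext X₀
  rw [← sub_eq_zero]
  refine (bilinForm_nondegenerate g x).1 _ fun Z₀ ↦ ?_
  change g.inner x (leviCivita g Y x X₀ - A X₀) Z₀ = 0
  have h1 := hL X₀ Z₀
  have h2 := hA X₀ Z₀
  rw [map_sub, sub_apply]
  linarith

variable [FiniteDimensional ℝ E]

instance (x : M) : FiniteDimensional ℝ (TangentSpace I x) :=
  inferInstanceAs (FiniteDimensional ℝ E)

/-- The musical isomorphism `♯ : T*_x M → T_x M` of the metric `g`. -/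
def sharp (g : SmoothMetric I M) (x : M) :
    Dual ℝ (TangentSpace I x) ≃ₗ[ℝ] TangentSpace I x :=
  ((bilinForm g x).toDual (bilinForm_nondegenerate g x)).symm

/-- The scalar product of two differentiable vector fields is differentiable. -/
theorem mdiffAt_inner (g : SmoothMetric I M) {x : M} {X Y : Π x : M, TangentSpace I x}
    (hX : MDiffAt (T% X) x) (hY : MDiffAt (T% Y) x) :
    MDiffAt (fun y ↦ g.inner y (X y) (Y y)) x := by
  have h : MDifferentiableAt I (I.prod 𝓘(ℝ)) (fun y : M ↦ TotalSpace.mk' ℝ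
      (E := Bundle.Trivial M ℝ) y (g.inner y (X y) (Y y))) x :=
    MDifferentiableAt.clm_bundle_apply₂ (F₁ := E) (F₂ := E)
      (g.contMDiff.contMDiffAt.mdifferentiableAt (by simp)) hX hY
  rw [mdifferentiableAt_totalSpace] at h
  exact h.2

/-- The Koszul expression is tensorial in `X`. -/
theorem koszul_tensorial_left (g : SmoothMetric I M) {x : M} {Y Z : Π x : M, TangentSpace I x}
    (hY : MDiffAt (T% Y) x) (hZ : MDiffAt (T% Z) x) :
    TensorialAt I E (fun X ↦ koszul g X Y Z x) x where
  smul {f X} hf hX := by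
    have e1 : (fun y ↦ g.inner y ((f • X) y) (Z y)) = fun y ↦ f y * g.inner y (X y) (Z y) := by
      ext y; simp
    have e2 : (fun y ↦ g.inner y ((f • X) y) (Y y)) = fun y ↦ f y * g.inner y (X y) (Y y) := by
      ext y; simp
    simp only [koszul, e1, e2, mvfderiv_fun_mul hf (mdiffAt_inner g hX hZ),
      mvfderiv_fun_mul hf (mdiffAt_inner g hX hY), VectorField.mlieBracket_smul_left hf hX]
    simp [g.symm x (X x) (Y x), g.symm x (X x) (Z x)]
    ring
  add {X X'} hX hX' := by
    have e (W : Π x : M, TangentSpace I x) : (fun y ↦ g.inner y ((X + X') y) (W y)) =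
        fun y ↦ g.inner y (X y) (W y) + g.inner y (X' y) (W y) := by
      ext y; simp
    simp only [koszul, e, mvfderiv_fun_add (mdiffAt_inner g hX hZ) (mdiffAt_inner g hX' hZ),
      mvfderiv_fun_add (mdiffAt_inner g hX hY) (mdiffAt_inner g hX' hY),
      VectorField.mlieBracket_add_left hX hX']
    simp
    ring

/-- The Koszul expression is tensorial in `Z`. -/
theorem koszul_tensorial_right (g : SmoothMetric I M) {x : M} {X Y : Π x : M, TangentSpace I x}
    (hX : MDiffAt (T% X) x) (hY : MDiffAt (T% Y) x) :
    TensorialAt I E (fun Z ↦ koszul g X Y Z x) x where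
  smul {f Z} hf hZ := by
    have e (W : Π x : M, TangentSpace I x) : (fun y ↦ g.inner y (W y) ((f • Z) y)) =
        fun y ↦ f y * g.inner y (W y) (Z y) := by
      ext y; simp
    simp only [koszul, e, mvfderiv_fun_mul hf (mdiffAt_inner g hX hZ),
      mvfderiv_fun_mul hf (mdiffAt_inner g hY hZ), VectorField.mlieBracket_smul_right hf hZ]
    simp [g.symm x (Z x) (Y x), g.symm x (Z x) (X x)]
    ring
  add {Z Z'} hZ hZ' := by
    have e (W : Π x : M, TangentSpace I x) : (fun y ↦ g.inner y (W y) ((Z + Z') y)) =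
        fun y ↦ g.inner y (W y) (Z y) + g.inner y (W y) (Z' y) := by
      ext y; simp
    simp only [koszul, e, mvfderiv_fun_add (mdiffAt_inner g hX hZ) (mdiffAt_inner g hX hZ'),
      mvfderiv_fun_add (mdiffAt_inner g hY hZ) (mdiffAt_inner g hY hZ'),
      VectorField.mlieBracket_add_right hZ hZ']
    simp
    ring

/-- The Koszul formula holds for all differentiable vector fields `X`, `Y`, `Z`. -/
theorem two_inner_leviCivita (g : SmoothMetric I M) {x : M} {X Y Z : Π x : M, TangentSpace I x}
    (hX : MDiffAt (T% X) x) (hY : MDiffAt (T% Y) x) (hZ : MDiffAt (T% Z) x) :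
    2 * g.inner x (leviCivita g Y x (X x)) (Z x) = koszul g X Y Z x := by
  let Φ : TangentSpace I x →L[ℝ] TangentSpace I x →L[ℝ] ℝ :=
    TensorialAt.mkHom₂ (fun X Z ↦ koszul g X Y Z x) x
      (fun Z hZ ↦ koszul_tensorial_left g hY hZ) (fun X hX ↦ koszul_tensorial_right g hX hY)
  have hΦ : Φ (X x) (Z x) = koszul g X Y Z x := TensorialAt.mkHom₂_apply _ _ hX hZ
  let L : TangentSpace I x →ₗ[ℝ] TangentSpace I x :=
    (1 / 2 : ℝ) • (sharp g x).toLinearMap ∘ₗ (ContinuousLinearMap.coeLM ℝ) ∘ₗ Φ.toLinearMap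
  have : T2Space (TangentSpace I x) := inferInstanceAs (T2Space E)
  let A : TangentSpace I x →L[ℝ] TangentSpace I x := LinearMap.toContinuousLinearMap L
  have hA (X₀ Z₀ : TangentSpace I x) : 2 * g.inner x (A X₀) Z₀ = Φ X₀ Z₀ := by
    have h : g.inner x (sharp g x (Φ X₀ : Dual ℝ (TangentSpace I x))) Z₀ = Φ X₀ Z₀ :=
      LinearMap.BilinForm.apply_toDual_symm_apply (hB := bilinForm_nondegenerate g x) _ Z₀
    change 2 * g.inner x ((1 / 2 : ℝ) • sharp g x (Φ X₀ : Dual ℝ (TangentSpace I x))) Z₀ = _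
    rw [map_smul, smul_apply, h]
    simp
  rw [leviCivita_eq g Y x A hA, hA, hΦ]

/-- A positive definite form on a finite-dimensional space has a bounded unit ball. -/
theorem isVonNBounded_of_pos (B : E →L[ℝ] E →L[ℝ] ℝ) (h : ∀ v, v ≠ 0 → 0 < B v v) :
    Bornology.IsVonNBounded ℝ {v : E | B v v < 1} := by
  have hc : ∃ c : ℝ, 0 < c ∧ ∀ v ∈ Metric.sphere (0 : E) 1, c ≤ B v v := by
    rcases (Metric.sphere (0 : E) 1).eq_empty_or_nonempty with he | hne
    · exact ⟨1, one_pos, by simp [he]⟩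
    · obtain ⟨v, hv, hmin⟩ := (isCompact_sphere (0 : E) 1).exists_isMinOn hne
        (f := fun v ↦ B v v) (B.continuous.clm_apply continuous_id).continuousOn
      refine ⟨B v v, h v ?_, fun w hw ↦ hmin hw⟩
      rintro rfl
      simp at hv
  obtain ⟨c, hc, hB⟩ := hc
  rw [NormedSpace.isVonNBounded_iff, isBounded_iff_forall_norm_le]
  refine ⟨√(1 / c), fun v hv ↦ ?_⟩
  apply Real.le_sqrt_of_sq_le
  rcases eq_or_ne v 0 with rfl | hv0
  · simp [hc.le]
  have hn : 0 < ‖v‖ := norm_pos_iff.2 hv0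
  have h1 := hB (‖v‖⁻¹ • v) (by simp [norm_smul, hn.ne'])
  simp only [map_smul, smul_apply, smul_eq_mul] at h1
  rw [le_div_iff₀ hc]
  have h2 : (B v) v < 1 := hv
  have : B v v = ‖v‖ ^ 2 * (‖v‖⁻¹ * (‖v‖⁻¹ * B v v)) := by field_simp
  nlinarith [sq_nonneg ‖v‖, mul_le_mul_of_nonneg_left h1 (sq_nonneg ‖v‖)]

set_option maxHeartbeats 400000 in
/-- A field of bilinear forms is smooth if it is smooth on smooth vector fields. -/
theorem contMDiff_of_apply (g : Π x : M, TangentSpace I x →L[ℝ] TangentSpace I x →L[ℝ] ℝ)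
    (hg : ∀ (x : M) (X Y : Π x : M, TangentSpace I x),
      CMDiffAt ∞ (T% X) x → CMDiffAt ∞ (T% Y) x → CMDiffAt ∞ (fun y ↦ g y (X y) (Y y)) x) :
    ContMDiff I (I.prod 𝓘(ℝ, E →L[ℝ] E →L[ℝ] ℝ)) ∞
      (fun x ↦ TotalSpace.mk' (E →L[ℝ] E →L[ℝ] ℝ) x (g x)) := by
  intro x₀
  rw [contMDiffAt_hom_bundle]
  refine ⟨contMDiffAt_id, ?_⟩
  set b := Module.finBasis ℝ E
  let K (i j) : E →L[ℝ] E →L[ℝ] ℝ :=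
    (LinearMap.toContinuousLinearMap (b.coord i)).smulRight
      (LinearMap.toContinuousLinearMap (b.coord j))
  let t := trivializationAt E (TangentSpace I : M → Type _) x₀
  have key : ∀ᶠ x in 𝓝 x₀,
      ContinuousLinearMap.inCoordinates E (fun x : M ↦ TangentSpace I x) (E →L[ℝ] ℝ)
        (fun x ↦ TangentSpace I x →L[ℝ] ℝ) x₀ x x₀ x (g x)
      = ∑ i, ∑ j, (g x (FiberBundle.extend E (t.symm x₀ (b i)) x)
          (FiberBundle.extend E (t.symm x₀ (b j)) x)) • K i j := by
    have hx0 : x₀ ∈ t.baseSet := FiberBundle.mem_baseSet_trivializationAt' x₀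
    filter_upwards [t.open_baseSet.mem_nhds hx0] with x hx
    apply ContinuousLinearMap.coe_injective
    refine b.ext fun i ↦ ?_
    apply ContinuousLinearMap.coe_injective
    refine b.ext fun j ↦ ?_
    have := inCoordinates_apply_eq₂ (𝕜 := ℝ) (F₁ := E) (F₂ := E) (F₃ := ℝ)
      (E₁ := fun x : M ↦ TangentSpace I x) (E₂ := fun x : M ↦ TangentSpace I x)
      (E₃ := Bundle.Trivial M ℝ) (x₀ := x₀) (x := x) (ϕ := g x) (v := b i) (w := b j) hx hx
      (Set.mem_univ _)
    refine Eq.trans this ?_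
    have hs (v : E) : (t ⟨x₀, t.symm x₀ v⟩).2 = v := by
      rw [t.apply_mk_symm hx0]
    have he (v : E) : FiberBundle.extend E (t.symm x₀ v) x = t.symm x v :=
      congrArg (t.symm x) (hs v)
    simp only [he]
    simp [K, Finsupp.single_apply, t]
  refine ContMDiffAt.congr_of_eventuallyEq ?_ key
  refine ContMDiffAt.sum fun i _ ↦ ContMDiffAt.sum fun j _ ↦ ?_
  refine ContMDiffAt.smul (hg x₀ _ _ ?_ ?_) contMDiffAt_const
  all_goals exact FiberBundle.contMDiffAt_extend I E _

/-- The metric `c • g` for a constant `c > 0`. -/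
def scaleMetric (c : ℝ) (hc : 0 < c) (g : SmoothMetric I M) : SmoothMetric I M where
  inner x := c • g.inner x
  symm x v w := congrArg (c * ·) (g.symm x v w)
  pos x v hv := mul_pos hc (g.pos x v hv)
  isVonNBounded x := isVonNBounded_of_pos (E := E) (c • g.inner x)
    fun v hv ↦ mul_pos hc (g.pos x v hv)
  contMDiff := by
    refine contMDiff_of_apply _ fun x X Y hX hY ↦ ?_
    have h : ContMDiffAt I (I.prod 𝓘(ℝ)) ∞ (fun y : M ↦ TotalSpace.mk' ℝ
        (E := Bundle.Trivial M ℝ) y (g.inner y (X y) (Y y))) x :=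
      ContMDiffAt.clm_bundle_apply₂ (F₁ := E) (F₂ := E) g.contMDiff.contMDiffAt hX hY
    rw [contMDiffAt_totalSpace] at h
    exact contMDiffAt_const.mul h.2

end Riemannian

/-! ### Dirac bundles -/

section Dirac

variable (𝕜 : Type*) [RCLike 𝕜]
  {E : Type*} [NormedAddCommGroup E] [NormedSpace ℝ E]
  {H : Type*} [TopologicalSpace H] (I : ModelWithCorners ℝ E H)
  {M : Type*} [TopologicalSpace M] [ChartedSpace H M]
  (V : M → Type*) [∀ x, AddCommGroup (V x)] [∀ x, Module ℝ (V x)]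
  [∀ x, TopologicalSpace (V x)] [∀ x, IsTopologicalAddGroup (V x)]
  [∀ x, ContinuousSMul ℝ (V x)]

/-- The data of a Dirac bundle on the family of vector spaces `V` over `M`: the fibrewise form
`⟨·,·⟩`, the operator `∇` with `∇_X σ (x) = conn σ x (X x)`, and the Clifford multiplication `γ`
by tangent vectors. The axioms are in `DiracData.IsDiracBundle`. -/
structure DiracData where
  herm : Π x : M, V x →L[ℝ] V x →L[ℝ] 𝕜
  conn : (Π x : M, V x) → Π x : M, TangentSpace I x →L[ℝ] V x
  cliff : Π x : M, TangentSpace I x →L[ℝ] V x →L[ℝ] V x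

variable {𝕜 I V}

/-- The axioms of a Dirac bundle over the Riemannian manifold `(M, g)`. For `𝕜 = ℂ` the bundle is
Hermitian, for `𝕜 = ℝ` it is Riemannian. By the universal property of the Clifford algebra, a
homomorphism of bundles of real algebras from `Cl(M, g)` to the endomorphisms of `V` is the same
thing as a linear map `γ` on `TM` with `γ(v)² = -g(v, v)`, and compatibility with the connection
on sections of `Cl(M, g)` is the same as compatibility on vector fields. -/
structure DiracData.IsDiracBundle [IsManifold I ∞ M]
    (F : Type*) [NormedAddCommGroup F] [NormedSpace ℝ F]
    [TopologicalSpace (TotalSpace F V)] [FiberBundle F V] [VectorBundle ℝ F V]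
    [ContMDiffVectorBundle ∞ F V I] [∀ x, Module 𝕜 (V x)]
    (S : DiracData 𝕜 I V) (g : SmoothMetric I M) : Prop where
  herm_conj : ∀ x (a b : V x), S.herm x b a = starRingEnd 𝕜 (S.herm x a b)
  herm_smul : ∀ x (c : 𝕜) (a b : V x), S.herm x a (c • b) = c * S.herm x a b
  herm_pos : ∀ x (a : V x), a ≠ 0 → 0 < RCLike.re (S.herm x a a)
  herm_smooth : ContMDiff I (I.prod 𝓘(ℝ, F →L[ℝ] F →L[ℝ] 𝕜)) ∞
    (fun x ↦ TotalSpace.mk' (F →L[ℝ] F →L[ℝ] 𝕜) x (S.herm x))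
  conn_cov : IsCovariantDerivativeOn F S.conn
  conn_smul : ∀ (x : M) (c : 𝕜) (σ : Π x : M, V x), MDiffAt (T% σ) x →
    ∀ X : TangentSpace I x, S.conn (fun y ↦ c • σ y) x X = c • S.conn σ x X
  conn_smooth : ContMDiffCovariantDerivativeOn F ∞ S.conn Set.univ
  cliff_smul : ∀ x (v : TangentSpace I x) (c : 𝕜) (a : V x),
    S.cliff x v (c • a) = c • S.cliff x v a
  cliff_sq : ∀ x (v : TangentSpace I x) (a : V x),
    S.cliff x v (S.cliff x v a) = -(g.inner x v v) • a
  cliff_smooth : ContMDiff I (I.prod 𝓘(ℝ, E →L[ℝ] F →L[ℝ] F)) ∞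
    (fun x ↦ TotalSpace.mk' (E →L[ℝ] F →L[ℝ] F) x (S.cliff x))
  cliff_skew : ∀ x (v : TangentSpace I x) (a b : V x),
    S.herm x (S.cliff x v a) b = -S.herm x a (S.cliff x v b)
  conn_herm : ∀ (x : M) (σ τ : Π x : M, V x), MDiffAt (T% σ) x → MDiffAt (T% τ) x →
    ∀ X : TangentSpace I x, mvfderiv I (fun y ↦ S.herm y (σ y) (τ y)) x X =
      S.herm x (S.conn σ x X) (τ x) + S.herm x (σ x) (S.conn τ x X)
  conn_cliff : ∀ (x : M) (Y : Π x : M, TangentSpace I x) (σ : Π x : M, V x),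
    MDiffAt (T% Y) x → MDiffAt (T% σ) x → ∀ X : TangentSpace I x,
    S.conn (fun y ↦ S.cliff y (Y y) (σ y)) x X =
      S.cliff x (leviCivita g Y x X) (σ x) + S.cliff x (Y x) (S.conn σ x X)

/-- The linear map `X ↦ γ(X) a` on `T_x M`, for a fixed vector `a` of the fibre `V x`. -/
def cliffOn (S : DiracData 𝕜 I V) (x : M) (a : V x) : TangentSpace I x →L[ℝ] V x where
  toFun X := S.cliff x X a
  map_add' := by simp
  map_smul' := by simp
  cont := (continuous_eval_const a).comp (S.cliff x).continuous

variable [FiniteDimensional ℝ E] [IsManifold I ∞ M]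

/-- The Dirac operator `Q = γ ∘ (♯ ⊗ id) ∘ ∇`. For a basis `b` of `T_x M` with dual basis `b*`,
`(∇σ)(x) = ∑ i, b*ᵢ ⊗ ∇_{bᵢ} σ`, so that `Qσ(x) = ∑ i, γ(♯ b*ᵢ) ∇_{bᵢ} σ`. -/
def diracOperator (S : DiracData 𝕜 I V) (g : SmoothMetric I M) (σ : Π x : M, V x) (x : M) : V x :=
  ∑ i, S.cliff x (sharp g x ((Module.finBasis ℝ (TangentSpace I x)).coord i))
    (S.conn σ x (Module.finBasis ℝ (TangentSpace I x) i))

/-- The Dirac Laplacian `P = Q²`. -/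
def diracLaplacian (S : DiracData 𝕜 I V) (g : SmoothMetric I M) (σ : Π x : M, V x) :
    Π x : M, V x :=
  diracOperator S g (diracOperator S g σ)

end Dirac

/-! ### Warped products -/

section Warped

variable {n : ℕ} {t : ℝ} [Fact (0 < t)] {N : Type*} [TopologicalSpace N]
  [ChartedSpace (EuclideanSpace ℝ (Fin n)) N]

/-- The model with corners of `[0,t] × N`, for `N` of dimension `n` without boundary. -/
abbrev cylModel (n : ℕ) := (𝓡∂ 1).prod (𝓡 n)

/-- The cylinder `Z = [0,t] × N`. -/
abbrev Cyl (t : ℝ) (N : Type*) := Icc (0 : ℝ) t × N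

/-- The one-form `du` on the cylinder. -/
def du (z : Cyl t N) : TangentSpace (cylModel n) z →L[ℝ] ℝ :=
  mvfderiv (cylModel n) (fun z : Cyl t N ↦ (z.1 : ℝ)) z

/-- The differential of the projection `[0,t] × N → N`. -/
def dprN (z : Cyl t N) : TangentSpace (cylModel n) z →L[ℝ] TangentSpace (𝓡 n) z.2 :=
  mfderiv (cylModel n) (𝓡 n) (Prod.snd : Cyl t N → N) z

/-- The vector field `∂_u` on the cylinder. -/
def ddu (z : Cyl t N) : TangentSpace (cylModel n) z :=
  mfderiv (𝓡∂ 1) (cylModel n) (fun v : Icc (0 : ℝ) t ↦ (v, z.2)) z.1 1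

/-- The differential at `x` of the inclusion `ι_u : N → [0,t] × N`, `y ↦ (u, y)`, of the slice
`N_u`. -/
def dslice (u : Icc (0 : ℝ) t) (x : N) :
    TangentSpace (𝓡 n) x →L[ℝ] TangentSpace (cylModel n) ((u, x) : Cyl t N) :=
  mfderiv (𝓡 n) (cylModel n) (fun y : N ↦ ((u, y) : Cyl t N)) x

theorem mvfderiv_coe_eq_zero (u : Icc (0 : ℝ) t) (a : TangentSpace (𝓡∂ 1) u)
    (h : mvfderiv (𝓡∂ 1) (Subtype.val : Icc (0 : ℝ) t → ℝ) u a = 0) : a = 0 := by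
  have h1 : mvfderiv (𝓡∂ 1) (Subtype.val : Icc (0 : ℝ) t → ℝ) u 1 = 1 :=
    mfderiv_subtypeVal_Icc_one u
  have hd : finrank ℝ (TangentSpace (𝓡∂ 1) u) = 1 :=
    (finrank_euclideanSpace_fin (𝕜 := ℝ) (n := 1))
  have hne : (1 : TangentSpace (𝓡∂ 1) u) ≠ 0 := by
    intro h0
    rw [h0, map_zero] at h1
    exact zero_ne_one h1
  obtain ⟨c, rfl⟩ := (finrank_eq_one_iff_of_nonzero' _ hne).1 hd a
  rw [map_smul, h1] at h
  simp at h
  simp [h]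

theorem du_apply (z : Cyl t N) (v : TangentSpace (cylModel n) z) :
    du z v = mvfderiv (𝓡∂ 1) (Subtype.val : Icc (0 : ℝ) t → ℝ) z.1 v.1 := by
  unfold du mvfderiv
  have := mfderiv_comp (I := cylModel n) (I' := 𝓡∂ 1) (I'' := 𝓘(ℝ, ℝ)) z
    (f := (Prod.fst : Cyl t N → _)) (g := (Subtype.val : Icc (0 : ℝ) t → ℝ))
    ((contMDiff_subtypeVal_Icc (n := 1) _).mdifferentiableAt one_ne_zero) mdifferentiableAt_fst
  have h2 := congrArg (fun L => L v) this
  rw [mfderiv_fst] at h2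
  exact h2

theorem dprN_apply (z : Cyl t N) (v : TangentSpace (cylModel n) z) : dprN z v = v.2 := by
  unfold dprN
  rw [mfderiv_snd]
  rfl

variable [IsManifold (𝓡 n) ∞ N]

/-- The form `du² + ρ(u)² dσ²` at the point `z = (u, x)`, where `dσ²` is the metric `gN`. -/
def warpedInner (gN : SmoothMetric (𝓡 n) N) (ρ : ℝ → ℝ) (z : Cyl t N) :
    TangentSpace (cylModel n) z →L[ℝ] TangentSpace (cylModel n) z →L[ℝ] ℝ :=
  (du z).smulRight (du z)
    + (ρ z.1) ^ 2 • (ContinuousLinearMap.precomp ℝ (dprN z) ∘L gN.inner z.2 ∘L dprN z)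

theorem warpedInner_apply (gN : SmoothMetric (𝓡 n) N) (ρ : ℝ → ℝ) (z : Cyl t N)
    (v w : TangentSpace (cylModel n) z) : warpedInner gN ρ z v w =
      du z v * du z w + (ρ z.1) ^ 2 * gN.inner z.2 (dprN z v) (dprN z w) := rfl

theorem warpedInner_pos (gN : SmoothMetric (𝓡 n) N) (ρ : ℝ → ℝ) (z : Cyl t N)
    (h0 : ρ z.1 ≠ 0) (v : TangentSpace (cylModel n) z) (hv : v ≠ 0) :
    0 < warpedInner gN ρ z v v := by
  rw [warpedInner_apply]
  have hn : 0 ≤ gN.inner z.2 (dprN z v) (dprN z v) := by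
    rcases eq_or_ne (dprN z v) 0 with h | h
    · simp [h]
    · exact (gN.pos _ _ h).le
  by_cases h : du z v = 0
  · have h2 : dprN z v ≠ 0 := by
      intro h'
      apply hv
      rw [du_apply] at h
      rw [dprN_apply] at h'
      exact Prod.ext (mvfderiv_coe_eq_zero _ _ h) h'
    have h3 := gN.pos _ _ h2
    have h4 : 0 < (ρ z.1) ^ 2 := sq_pos_of_ne_zero h0
    rw [h, mul_zero, zero_add]
    exact mul_pos h4 h3
  · have h1 : 0 < du z v * du z v := mul_self_pos.2 h
    positivity

set_option maxHeartbeats 800000 in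
theorem warpedInner_smooth (gN : SmoothMetric (𝓡 n) N) (ρ : ℝ → ℝ)
    (hρ : ContDiffOn ℝ ∞ ρ (Icc 0 t)) :
    ContMDiff (cylModel n) ((cylModel n).prod
      𝓘(ℝ, (EuclideanSpace ℝ (Fin 1) × EuclideanSpace ℝ (Fin n)) →L[ℝ]
        (EuclideanSpace ℝ (Fin 1) × EuclideanSpace ℝ (Fin n)) →L[ℝ] ℝ)) ∞
      (fun z : Cyl t N ↦ TotalSpace.mk'
        ((EuclideanSpace ℝ (Fin 1) × EuclideanSpace ℝ (Fin n)) →L[ℝ]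
          (EuclideanSpace ℝ (Fin 1) × EuclideanSpace ℝ (Fin n)) →L[ℝ] ℝ)
        z (warpedInner gN ρ z)) := by
  apply contMDiff_of_apply
  intro z X Y hX hY
  have hdu (X : Π z : Cyl t N, TangentSpace (cylModel n) z) 
      (hX : ContMDiffAt (cylModel n) (cylModel n).tangent ∞
        (fun z ↦ (⟨z, X z⟩ : TangentBundle (cylModel n) (Cyl t N))) z) :
      ContMDiffAt (cylModel n) 𝓘(ℝ, ℝ) ∞ (fun z ↦ du z (X z)) z := by
    have hf : ContMDiff (cylModel n) 𝓘(ℝ, ℝ) ∞ (fun z : Cyl t N ↦ (z.1 : ℝ)) :=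
      contMDiff_subtypeVal_Icc.comp contMDiff_fst
    have := ((hf.contMDiff_tangentMap (m := ∞) (by simp)).contMDiffAt (x := ⟨z, X z⟩)).comp z hX
    rw [contMDiffAt_totalSpace] at this
    simpa using! this.2
  have hdp (X : Π z : Cyl t N, TangentSpace (cylModel n) z) 
      (hX : ContMDiffAt (cylModel n) (cylModel n).tangent ∞
        (fun z ↦ (⟨z, X z⟩ : TangentBundle (cylModel n) (Cyl t N))) z) :
      ContMDiffAt (cylModel n) (𝓡 n).tangent ∞
        (fun z ↦ (⟨z.2, dprN z (X z)⟩ : TangentBundle (𝓡 n) N)) z := by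
    have hf : ContMDiff (cylModel n) (𝓡 n) ∞ (Prod.snd : Cyl t N → N) := contMDiff_snd
    exact ((hf.contMDiff_tangentMap (m := ∞) (by simp)).contMDiffAt (x := ⟨z, X z⟩)).comp z hX
  have hr : ContMDiffAt (cylModel n) 𝓘(ℝ, ℝ) ∞ (fun z : Cyl t N ↦ ρ z.1) z := by
    have : ContMDiff (cylModel n) 𝓘(ℝ, ℝ) ∞ (fun z : Cyl t N ↦ ρ z.1) :=
      hρ.contMDiffOn.comp_contMDiff (contMDiff_subtypeVal_Icc.comp contMDiff_fst) (fun z ↦ z.1.2)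
    exact this z
  have hg : ContMDiffAt (cylModel n) 𝓘(ℝ, ℝ) ∞ (fun z : Cyl t N ↦ gN.inner z.2 (dprN z (X z)) (dprN z (Y z))) z := by
    have : ContMDiffAt (cylModel n) ((𝓡 n).prod 𝓘(ℝ)) ∞
        (fun m : Cyl t N ↦ TotalSpace.mk' ℝ (E := Bundle.Trivial N ℝ) m.2
          (gN.inner m.2 (dprN m (X m)) (dprN m (Y m)))) z := by
      apply ContMDiffAt.clm_bundle_apply₂ (F₁ := EuclideanSpace ℝ (Fin n))
        (F₂ := EuclideanSpace ℝ (Fin n))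
      · exact ContMDiffAt.comp z gN.contMDiff.contMDiffAt contMDiffAt_snd
      · exact hdp X hX
      · exact hdp Y hY
    rw [contMDiffAt_totalSpace] at this
    exact this.2
  exact ((hdu X hX).mul (hdu Y hY)).add ((hr.pow 2).mul hg)

/-- The warped product metric `g = du² + ρ(u)² dσ²` on `[0,t] × N`. -/
def warpedMetric (gN : SmoothMetric (𝓡 n) N) (ρ : ℝ → ℝ) (hρ : ContDiffOn ℝ ∞ ρ (Icc 0 t))
    (hρ0 : ∀ u ∈ Icc 0 t, ρ u ≠ 0) : SmoothMetric (cylModel n) (Cyl t N) where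
  inner := warpedInner gN ρ
  symm z v w := by
    rw [warpedInner_apply, warpedInner_apply, gN.symm, mul_comm (du z v)]
  pos z v hv := warpedInner_pos gN ρ z (hρ0 z.1 z.1.2) v hv
  isVonNBounded z :=
    isVonNBounded_of_pos (E := EuclideanSpace ℝ (Fin 1) × EuclideanSpace ℝ (Fin n))
      (warpedInner gN ρ z) fun v hv ↦ warpedInner_pos gN ρ z (hρ0 z.1 z.1.2) v hv
  contMDiff := warpedInner_smooth gN ρ hρ

/-- The metric `ρ(u)² dσ²` on the slice `N_u`. -/
def sliceMetric (gN : SmoothMetric (𝓡 n) N) (ρ : ℝ → ℝ) (hρ0 : ∀ u ∈ Icc 0 t, ρ u ≠ 0)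
    (u : Icc (0 : ℝ) t) : SmoothMetric (𝓡 n) N :=
  scaleMetric ((ρ u) ^ 2) (sq_pos_of_ne_zero (hρ0 u u.2)) gN

/-- The metric of the slice `N_u` is the restriction of the warped product metric. -/
theorem sliceMetric_eq (gN : SmoothMetric (𝓡 n) N) (ρ : ℝ → ℝ)
    (hρ : ContDiffOn ℝ ∞ ρ (Icc 0 t)) (hρ0 : ∀ u ∈ Icc 0 t, ρ u ≠ 0) (u : Icc (0 : ℝ) t) (x : N)
    (v w : TangentSpace (𝓡 n) x) : (sliceMetric gN ρ hρ0 u).inner x v w =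
      (warpedMetric gN ρ hρ hρ0).inner (u, x) (dslice u x v) (dslice u x w) := by
  have h1 (v : TangentSpace (𝓡 n) x) : (dslice u x v).1 = 0 := by
    unfold dslice
    rw [mfderiv_prod_right]
    rfl
  have h2 (v : TangentSpace (𝓡 n) x) : (dslice u x v).2 = v := by
    unfold dslice
    rw [mfderiv_prod_right]
    rfl
  have h3 (v : TangentSpace (𝓡 n) x) : du (u, x) (dslice u x v) = 0 := by
    rw [du_apply, h1]
    exact map_zero (mvfderiv (𝓡∂ 1) (Subtype.val : Icc (0 : ℝ) t → ℝ) u)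
  change ρ u ^ 2 * gN.inner x v w = warpedInner gN ρ (u, x) (dslice u x v) (dslice u x w)
  rw [warpedInner_apply, dprN_apply, dprN_apply, h2, h2, h3, zero_mul, zero_add]

/-! ### The slices of a Dirac bundle over a warped product -/

variable {𝕜 : Type*} [RCLike 𝕜] (F : Type*) [NormedAddCommGroup F]
  {V : Cyl t N → Type*} [∀ z, AddCommGroup (V z)] [∀ z, Module ℝ (V z)]
  [∀ z, TopologicalSpace (V z)] [∀ z, IsTopologicalAddGroup (V z)]
  [∀ z, ContinuousSMul ℝ (V z)] [TopologicalSpace (TotalSpace F V)] [FiberBundle F V]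

/-- An extension to a neighbourhood of `(u, x)` in the cylinder of a section `s` of the bundle
over the slice `N_u`: in a local trivialization of `V` around `(u, x)`, its coordinates do not
depend on the first variable. -/
def extendSlice (u : Icc (0 : ℝ) t) (s : Π x : N, V (u, x)) (x : N) (z : Cyl t N) : V z :=
  (trivializationAt F V (u, x)).symm z (trivializationAt F V (u, x) ⟨(u, z.2), s z.2⟩).2

/-- The Dirac bundle structure induced on the slice `N_u`, with unit normal `ν = ∂_u`, on the
restricted bundle `V|_{N_u}`:
the restricted form `⟨·,·⟩`, the Clifford multiplication `γ_N(X) = -γ(ν) γ(X)`, and the connection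
`∇^N_X s = ∇_X s - ½ γ(ν) γ(∇^g_X ν) s`, where `∇_X s` for `X` tangent to `N_u` is computed
with an extension of `s` to a neighbourhood in the cylinder. -/
def sliceData (S : DiracData 𝕜 (cylModel n) V) (g : SmoothMetric (cylModel n) (Cyl t N))
    (u : Icc (0 : ℝ) t) : DiracData 𝕜 (𝓡 n) (fun x : N ↦ V (u, x)) where
  herm x := S.herm (u, x)
  cliff x := -(ContinuousLinearMap.postcomp (V (u, x)) (S.cliff (u, x) (ddu (u, x))) ∘L
    S.cliff (u, x) ∘L dslice u x)
  conn s x := S.conn (extendSlice F u s x) (u, x) ∘L dslice u x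
    - (1 / 2 : ℝ) • (S.cliff (u, x) (ddu (u, x)) ∘L cliffOn S (u, x) (s x) ∘L
      leviCivita g ddu (u, x) ∘L dslice u x)

/-- The Dirac operator `Q^N` of the slices, acting on sections over the cylinder: on `N_u` it is
the Dirac operator of the induced Dirac bundle, applied to the restriction of the section. -/
def sliceDirac (S : DiracData 𝕜 (cylModel n) V) (gN : SmoothMetric (𝓡 n) N) (ρ : ℝ → ℝ)
    (hρ : ContDiffOn ℝ ∞ ρ (Icc 0 t)) (hρ0 : ∀ u ∈ Icc 0 t, ρ u ≠ 0)
    (σ : Π z : Cyl t N, V z) (z : Cyl t N) : V z :=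
  diracOperator (sliceData F S (warpedMetric gN ρ hρ hρ0) z.1) (sliceMetric gN ρ hρ0 z.1)
    (fun x ↦ σ (z.1, x)) z.2

/-- The Dirac Laplacian `P^N = (Q^{N_u})²` of the slices, acting on sections over the cylinder. -/
def sliceLaplacian (S : DiracData 𝕜 (cylModel n) V) (gN : SmoothMetric (𝓡 n) N) (ρ : ℝ → ℝ)
    (hρ : ContDiffOn ℝ ∞ ρ (Icc 0 t)) (hρ0 : ∀ u ∈ Icc 0 t, ρ u ≠ 0)
    (σ : Π z : Cyl t N, V z) (z : Cyl t N) : V z :=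
  diracLaplacian (sliceData F S (warpedMetric gN ρ hρ hρ0) z.1) (sliceMetric gN ρ hρ0 z.1)
    (fun x ↦ σ (z.1, x)) z.2

/-- The operator `∇_{∂_u}`. -/
def nablaU (S : DiracData 𝕜 (cylModel n) V) (σ : Π z : Cyl t N, V z) (z : Cyl t N) : V z :=
  S.conn σ z (ddu z)

/-- The mean curvature `H = -ρ'/ρ` of the slices. -/
def meanCurvature (t : ℝ) (ρ : ℝ → ℝ) (u : ℝ) : ℝ :=
  -(derivWithin ρ (Icc 0 t) u / ρ u)

end Warped

end DiracGeometry

/-!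
Write `n = m - 1`, `ν = ∂_u`, `D = ∇^Z_ν`, `Q = Q^N`, and let `T = ∑ γ(eᵢ) ∇_{eᵢ}` be the tangential
part of `Q^Z`, so that `Q^Z = γ(ν) D + T`. The formula rests on two facts.

* `∇^g_X ν = -H X` for `X` tangent to a slice, and `∇^g_ν ν = 0` (`leviCivita_ddu`). This is the
  Koszul formula for coordinate fields, whose brackets vanish (`mlieBracket_extend`).
* `∑ γ(eᵢ) γ(eᵢ) = -n` over a frame of the slice (`sum_cliff_sharp_cliff`).

The first makes the connection on the slices differ from `∇^Z` by a multiple of `H γ_N(X)`, and the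
second sums these differences: `Q = -γ(ν) T + (n/2) H` (`sliceDirac_eq_tangentialDirac`). Hence
`Q^Z = γ(ν) (D + Q - (n/2) H)` (`diracOperator_eq_cliff_ddu`). The two facts also describe how `D`
and `T` pass `γ(ν)`, with the result `Q^Z γ(ν) = -D + Q + (n/2) H` (`diracOperator_cliff_ddu`).
Therefore
`P^Z = (-D + Q + (n/2) H) (D + Q - (n/2) H)`,
and the product, expanded with the Leibniz rule for `D` and the fact that `Q` commutes with
functions of `u`, is the assertion.

Two points need care because of the definitions. The connection on a slice is computed with one
particular extension of a section of the slice, so it has to be seen that `∇_X σ` depends only on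
the restriction of `σ` when `X` is tangent to the slice (`conn_apply_congr_of_comp_eq`). And the
second operator is applied to `(D + Q - (n/2) H) σ`, which has to be differentiable on the cylinder,
while `Q σ` is defined slice by slice; here `Q` is expressed by `Q^Z`, which preserves smoothness
because of the existence of smooth dual frames (`exists_contMDiffAt_dual_frame`).
-/

namespace DiracGeometry

set_option linter.unusedSectionVars false

/-! ### Coordinate vector fields commute -/

section CoordinateFields

variable {E : Type*} [NormedAddCommGroup E] [NormedSpace ℝ E]
  {H : Type*} [TopologicalSpace H] {I : ModelWithCorners ℝ E H}
  {M : Type*} [TopologicalSpace M] [ChartedSpace H M] [IsManifold I 1 M]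

/-- The extension of a tangent vector by `FiberBundle.extend` has constant coordinates in the chart:
it is the image of a constant field of the model space under the inverse of the chart. -/
theorem extend_eq_mfderivWithin {x₀ y : M} (v : TangentSpace I x₀)
    (hy : y ∈ (chartAt H x₀).source) :
    FiberBundle.extend E v y =
      mfderivWithin 𝓘(ℝ, E) I (extChartAt I x₀).symm (range I) (extChartAt I x₀ y) v := by
  rw [← TangentBundle.symmL_trivializationAt hy]
  have h : (trivializationAt E (TangentSpace I) x₀ ⟨x₀, v⟩).2 = v := by
    rw [TangentBundle.trivializationAt_apply]
    exact tangentCoordChange_self (I := I) (mem_extChartAt_source x₀)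
  rw [FiberBundle.extend, h]
  exact ((trivializationAt E (TangentSpace I) x₀).symmL_apply (R := ℝ)
    (show y ∈ (trivializationAt E (TangentSpace I) x₀).baseSet from hy) (v : E)).symm

theorem mfderiv_extend {E' : Type*} [NormedAddCommGroup E'] [NormedSpace ℝ E']
    {H' : Type*} [TopologicalSpace H'] {I' : ModelWithCorners ℝ E' H'}
    {M' : Type*} [TopologicalSpace M'] [ChartedSpace H' M'] {f : M → M'} {x₀ y : M}
    (v : TangentSpace I x₀) (hy : y ∈ (chartAt H x₀).source) (hf : MDifferentiableAt I I' f y) :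
    mfderiv I I' f y (FiberBundle.extend E v y) =
      mfderivWithin 𝓘(ℝ, E) I' (f ∘ (extChartAt I x₀).symm) (range I) (extChartAt I x₀ y) v := by
  have hy' : y ∈ (extChartAt I x₀).source := by rwa [extChartAt_source]
  have hmem : extChartAt I x₀ y ∈ (extChartAt I x₀).target := (extChartAt I x₀).map_source hy'
  rw [extend_eq_mfderivWithin v hy, mfderiv_comp_mfderivWithin_of_eq hf
    (mdifferentiableWithinAt_extChartAt_symm hmem)
    (I.uniqueMDiffOn _ (extChartAt_target_subset_range x₀ hmem))
    ((extChartAt I x₀).left_inv hy')]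
  rfl

/-- In the chart at `x₀` both fields are constant, so that their bracket vanishes. -/
theorem mlieBracket_extend [CompleteSpace E] (x₀ : M) (v w : TangentSpace I x₀) :
    VectorField.mlieBracket I (FiberBundle.extend E v) (FiberBundle.extend E w) x₀ = 0 := by
  have key (v : TangentSpace I x₀) : ∀ p ∈ (extChartAt I x₀).target,
      VectorField.mpullbackWithin 𝓘(ℝ, E) I (extChartAt I x₀).symm
        (FiberBundle.extend E v) (range I) p = v := by
    intro p hp
    have hs : (extChartAt I x₀).symm p ∈ (chartAt H x₀).source := by
      rw [← extChartAt_source I]; exact (extChartAt I x₀).map_target hp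
    rw [VectorField.mpullbackWithin_apply, extend_eq_mfderivWithin v hs,
      (extChartAt I x₀).right_inv hp]
    exact (isInvertible_mfderivWithin_extChartAt_symm hp).inverse_apply_eq.2 rfl
  have hnhds : (extChartAt I x₀).target ∈ 𝓝[range I] (extChartAt I x₀ x₀) :=
    extChartAt_target_mem_nhdsWithin x₀
  rw [← VectorField.mlieBracketWithin_univ, VectorField.mlieBracketWithin_apply]
  have hb : VectorField.lieBracketWithin ℝ
      (VectorField.mpullbackWithin 𝓘(ℝ, E) I (extChartAt I x₀).symm
        (FiberBundle.extend E v) (range I))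
      (VectorField.mpullbackWithin 𝓘(ℝ, E) I (extChartAt I x₀).symm
        (FiberBundle.extend E w) (range I))
      ((extChartAt I x₀).symm ⁻¹' univ ∩ range I) (extChartAt I x₀ x₀) = 0 := by
    rw [preimage_univ, univ_inter]
    have h0 := mem_extChartAt_target (I := I) x₀
    have hc (v : TangentSpace I x₀) : VectorField.mpullbackWithin 𝓘(ℝ, E) I (extChartAt I x₀).symm
        (FiberBundle.extend E v) (range I) =ᶠ[𝓝[range I] (extChartAt I x₀ x₀)]
        fun _ ↦ (v : E) := by
      filter_upwards [hnhds] with p hp using key v p hp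
    rw [Filter.EventuallyEq.lieBracketWithin_vectorField_eq_of_mem (hc v) (hc w)
      (mem_range_self _)]
    change fderivWithin ℝ (fun _ : E ↦ (w : E)) _ _ (v : E) -
      fderivWithin ℝ (fun _ : E ↦ (v : E)) _ _ (w : E) = 0
    rw [fderivWithin_fun_const, fderivWithin_fun_const]
    exact sub_zero 0
  rw [hb]
  exact map_zero _

end CoordinateFields

/-! ### Covariant derivatives along a map -/

section Tangential

variable {E : Type*} [NormedAddCommGroup E] [NormedSpace ℝ E]
  {H : Type*} [TopologicalSpace H] {I : ModelWithCorners ℝ E H}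
  {M : Type*} [TopologicalSpace M] [ChartedSpace H M]
  {E' : Type*} [NormedAddCommGroup E'] [NormedSpace ℝ E']
  {H' : Type*} [TopologicalSpace H'] {I' : ModelWithCorners ℝ E' H'}
  {M' : Type*} [TopologicalSpace M'] [ChartedSpace H' M']
  {F : Type*} [NormedAddCommGroup F] [NormedSpace ℝ F]
  {V : M → Type*} [TopologicalSpace (TotalSpace F V)]
  [∀ x, AddCommGroup (V x)] [∀ x, Module ℝ (V x)]
  [∀ x : M, TopologicalSpace (V x)]
  [∀ x, IsTopologicalAddGroup (V x)] [∀ x, ContinuousSMul ℝ (V x)]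
  [FiberBundle F V] [VectorBundle ℝ F V]
  {cov : (Π x : M, V x) → (Π x : M, TangentSpace I x →L[ℝ] V x)}

theorem isCovariantDerivativeOn_sum_smul (hcov : IsCovariantDerivativeOn F cov) {ι : Type*}
    (J : Finset ι) {f : ι → M → ℝ} {s : ι → Π x : M, V x} {x : M}
    (hf : ∀ i, MDiffAt (f i) x) (hs : ∀ i, MDiffAt (T% (s i)) x) :
    cov (fun y ↦ ∑ i ∈ J, f i y • s i y) x =
      ∑ i ∈ J, (f i x • cov (s i) x + (mvfderiv I (f i) x).smulRight (s i x)) := by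
  classical
  induction J using Finset.induction_on with
  | empty => simpa using! hcov.zero (x := x)
  | insert a J ha ih =>
    simp only [Finset.sum_insert ha]
    rw [← ih, ← hcov.leibniz (hs a) (hf a)]
    refine hcov.add (σ := f a • s a) (σ' := fun y ↦ ∑ i ∈ J, f i y • s i y)
      ((hf a).smul_section (hs a)) ?_
    exact MDifferentiableAt.sum_section fun i _ ↦ (hf i).smul_section (hs i)

/-- `∇_X σ`, for `X` tangent to the image of a map `f`, depends only on `σ ∘ f`. For the inclusion
of a submanifold this says that `∇_X σ` is determined by the restriction of `σ` as soon as `X` is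
tangent to it. -/
theorem conn_apply_congr_of_comp_eq [FiniteDimensional ℝ F] [ContMDiffVectorBundle 1 F V I]
    (hcov : IsCovariantDerivativeOn F cov) {f : M' → M} {x : M'}
    (hf : MDifferentiableAt I' I f x) {σ τ : Π x : M, V x}
    (hσ : MDiffAt (T% σ) (f x)) (hτ : MDiffAt (T% τ) (f x))
    (h : ∀ᶠ y in 𝓝 x, σ (f y) = τ (f y)) (v : TangentSpace I' x) :
    cov σ (f x) (mfderiv I' I f x v) = cov τ (f x) (mfderiv I' I f x v) := by
  set e := trivializationAt F V (f x)
  set b := Module.finBasis ℝ F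
  have he : f x ∈ e.baseSet := FiberBundle.mem_baseSet_trivializationAt' (f x)
  set δ : Π x : M, V x := σ - τ with hδ
  have hδd : MDiffAt (T% δ) (f x) := mdifferentiableAt_sub_section hσ hτ
  set c : Fin (finrank ℝ F) → M → ℝ := fun i ↦ LinearMap.piApply (e.localFrameCoeff I b i) δ
  have hc : ∀ i, MDiffAt (c i) (f x) := fun i ↦ mdifferentiableAt_localFrameCoeff b he hδd i
  have hs : ∀ i, MDiffAt (T% (e.localFrame b i)) (f x) := fun i ↦
    (contMDiffAt_localFrame_of_mem (I := I) 1 e b i he).mdifferentiableAt one_ne_zero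
  have hsum : cov δ (f x) = cov (fun y ↦ ∑ i, c i y • e.localFrame b i y) (f x) := by
    refine hcov.congr_of_eventuallyEq hδd ?_ Filter.univ_mem ?_
    · exact MDifferentiableAt.sum_section fun i _ ↦ (hc i).smul_section (hs i)
    · exact e.eventually_eq_localFrame_sum_coeff_smul b he
  have hc0 (i) : (c i) ∘ f =ᶠ[𝓝 x] fun _ ↦ (0 : ℝ) := by
    filter_upwards [h] with y hy
    simp [c, hδ, hy]
  have hδ0 : cov δ (f x) (mfderiv I' I f x v) = 0 := by
    rw [hsum, isCovariantDerivativeOn_sum_smul hcov _ hc hs]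
    -- The coefficients of `σ - τ` vanish along `f`, hence so do their derivatives along `f`.
    have hz (i) : mvfderiv I (c i) (f x) (mfderiv I' I f x v) = 0 := by
      rw [← mvfderiv_comp_apply x (hc i) hf]
      unfold mvfderiv
      rw [(hc0 i).mfderiv_eq, mfderiv_const]
      rfl
    have hz' (i) : c i (f x) = 0 := (hc0 i).eq_of_nhds
    simp [hz, hz']
  have hadd : cov σ (f x) = cov δ (f x) + cov τ (f x) := by
    rw [← hcov.add hδd hτ]; simp [hδ]
  rw [hadd, add_apply, hδ0, zero_add]

end Tangential

/-! ### Dirac operators in arbitrary frames -/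

section DiracOperator

variable {𝕜 : Type*} [RCLike 𝕜]
  {E : Type*} [NormedAddCommGroup E] [NormedSpace ℝ E] [FiniteDimensional ℝ E]
  {H : Type*} [TopologicalSpace H] {I : ModelWithCorners ℝ E H}
  {M : Type*} [TopologicalSpace M] [ChartedSpace H M] [IsManifold I ∞ M]
  {V : M → Type*} [∀ x, AddCommGroup (V x)] [∀ x, Module ℝ (V x)]
  [∀ x, TopologicalSpace (V x)] [∀ x, IsTopologicalAddGroup (V x)]
  [∀ x, ContinuousSMul ℝ (V x)]

theorem inner_sharp (g : SmoothMetric I M) (x : M) (φ : Dual ℝ (TangentSpace I x))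
    (v : TangentSpace I x) : g.inner x (sharp g x φ) v = φ v :=
  LinearMap.BilinForm.apply_toDual_symm_apply (hB := bilinForm_nondegenerate g x) φ v

theorem eq_of_inner_eq (g : SmoothMetric I M) {x : M} {v w : TangentSpace I x}
    (h : ∀ a, g.inner x v a = g.inner x w a) : v = w := by
  rw [← sub_eq_zero]
  refine (bilinForm_nondegenerate g x).1 _ fun a ↦ ?_
  change g.inner x (v - w) a = 0
  rw [map_sub, sub_apply, h, sub_self]

theorem sum_inner_sharp_smul (g : SmoothMetric I M) (x : M) (v : TangentSpace I x) :
    ∑ i, g.inner x (sharp g x ((Module.finBasis ℝ (TangentSpace I x)).coord i)) v •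
      Module.finBasis ℝ (TangentSpace I x) i = v := by
  simp only [inner_sharp, Basis.coord_apply]
  exact (Module.finBasis ℝ (TangentSpace I x)).sum_repr v

/-- The contraction of a bilinear map with the metric may be computed with any pair of families
`w`, `e` that is dual with respect to the metric, such as an orthonormal frame taken twice. -/
theorem sum_apply_sharp_eq (g : SmoothMetric I M) {x : M} {W : Type*} [AddCommGroup W]
    [Module ℝ W]
    (B : TangentSpace I x →ₗ[ℝ] TangentSpace I x →ₗ[ℝ] W) {ι : Type*} [Fintype ι]
    {w e : ι → TangentSpace I x} (h : ∀ v, ∑ j, g.inner x (w j) v • e j = v) :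
    ∑ i, B (sharp g x ((Module.finBasis ℝ (TangentSpace I x)).coord i))
      (Module.finBasis ℝ (TangentSpace I x) i) = ∑ j, B (w j) (e j) := by
  set b := Module.finBasis ℝ (TangentSpace I x)
  have hw (i) : sharp g x (b.coord i) = ∑ j, b.coord i (e j) • w j := by
    refine eq_of_inner_eq g fun a ↦ ?_
    rw [inner_sharp]
    conv_lhs => rw [← h a]
    simp only [map_sum, map_smul, sum_apply, smul_apply, smul_eq_mul]
    exact Finset.sum_congr rfl fun j _ ↦ mul_comm _ _
  calc ∑ i, B (sharp g x (b.coord i)) (b i)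
      = ∑ i, ∑ j, b.coord i (e j) • B (w j) (b i) := by
        refine Finset.sum_congr rfl fun i _ ↦ ?_
        rw [hw]
        simp only [map_sum, map_smul, LinearMap.sum_apply, LinearMap.smul_apply]
    _ = ∑ j, B (w j) (∑ i, b.coord i (e j) • b i) := by
        rw [Finset.sum_comm]
        simp only [map_sum, map_smul]
    _ = ∑ j, B (w j) (e j) := by
        refine Finset.sum_congr rfl fun j _ ↦ ?_
        exact congrArg _ (b.sum_repr (e j))

theorem diracOperator_eq_sum (S : DiracData 𝕜 I V) (g : SmoothMetric I M) (σ : Π x : M, V x)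
    {x : M} {ι : Type*} [Fintype ι] {w e : ι → TangentSpace I x}
    (h : ∀ v, ∑ j, g.inner x (w j) v • e j = v) :
    diracOperator S g σ x = ∑ j, S.cliff x (w j) (S.conn σ x (e j)) := by
  let B : TangentSpace I x →ₗ[ℝ] TangentSpace I x →ₗ[ℝ] V x :=
    LinearMap.mk₂ ℝ (fun v w ↦ S.cliff x v (S.conn σ x w)) (by simp) (by simp) (by simp) (by simp)
  exact sum_apply_sharp_eq g B h

theorem cliff_anticomm (S : DiracData 𝕜 I V) (g : SmoothMetric I M) {x : M}
    (hsq : ∀ (v : TangentSpace I x) (a : V x),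
      S.cliff x v (S.cliff x v a) = -(g.inner x v v) • a)
    (v w : TangentSpace I x) (a : V x) :
    S.cliff x v (S.cliff x w a) + S.cliff x w (S.cliff x v a) = -(2 * g.inner x v w) • a := by
  have h1 := hsq (v + w) a
  have h2 := hsq v a
  have h3 := hsq w a
  simp only [map_add, add_apply] at h1
  rw [h2, h3, g.symm x w v] at h1
  have : S.cliff x v (S.cliff x w a) + S.cliff x w (S.cliff x v a) =
      (-(g.inner x v v) • a + S.cliff x w (S.cliff x v a) +
        (S.cliff x v (S.cliff x w a) + -(g.inner x w w) • a))
        + (g.inner x v v) • a + (g.inner x w w) • a := by module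
  rw [this, h1]
  module

/-- For an orthonormal basis every summand is `γ(eᵢ)² = -1`. For a general basis `b`, the symmetry
of the Gram matrix allows `b` to be exchanged with its dual basis, and the Clifford relation is then
applied to the symmetrized sum. -/
theorem sum_cliff_sharp_cliff (S : DiracData 𝕜 I V) (g : SmoothMetric I M) {x : M}
    (hsq : ∀ (v : TangentSpace I x) (a : V x),
      S.cliff x v (S.cliff x v a) = -(g.inner x v v) • a) (a : V x) :
    ∑ i, S.cliff x (sharp g x ((Module.finBasis ℝ (TangentSpace I x)).coord i))
      (S.cliff x (Module.finBasis ℝ (TangentSpace I x) i) a) =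
      -(finrank ℝ E : ℝ) • a := by
  set b := Module.finBasis ℝ (TangentSpace I x)
  set w := fun i ↦ sharp g x (b.coord i)
  have hwb (i j) : g.inner x (w i) (b j) = if i = j then 1 else 0 := by
    simp only [w, inner_sharp, Basis.coord_apply, Basis.repr_self, Finsupp.single_apply]
    simp only [eq_comm]
  have hb (i) : b i = ∑ j, g.inner x (b i) (b j) • w j := by
    refine eq_of_inner_eq g fun v ↦ ?_
    conv_lhs => rw [← b.sum_repr v]
    simp only [map_sum, map_smul, sum_apply, smul_apply, smul_eq_mul]
    refine Finset.sum_congr rfl fun j _ ↦ ?_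
    rw [inner_sharp, Basis.coord_apply, mul_comm]
  have e1 : ∑ i, S.cliff x (w i) (S.cliff x (b i) a) =
      ∑ i, ∑ j, g.inner x (b i) (b j) • S.cliff x (w i) (S.cliff x (w j) a) := by
    refine Finset.sum_congr rfl fun i _ ↦ ?_
    conv_lhs => rw [hb i]
    simp only [map_sum, map_smul, sum_apply, smul_apply]
  -- By symmetry of the Gram matrix, the order of the two factors may be exchanged.
  have e2 : ∑ i, S.cliff x (w i) (S.cliff x (b i) a) =
      ∑ i, S.cliff x (b i) (S.cliff x (w i) a) := by
    rw [e1, Finset.sum_comm]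
    refine Finset.sum_congr rfl fun i _ ↦ ?_
    conv_rhs => rw [hb i]
    simp only [map_sum, map_smul, sum_apply, smul_apply]
    refine Finset.sum_congr rfl fun j _ ↦ ?_
    rw [g.symm]
  have e3 : (2 : ℝ) • ∑ i, S.cliff x (w i) (S.cliff x (b i) a) =
      (2 : ℝ) • (-(finrank ℝ E : ℝ) • a) := by
    rw [two_smul]
    conv_lhs => arg 2; rw [e2]
    rw [← Finset.sum_add_distrib]
    simp only [cliff_anticomm S g hsq, hwb]
    simp only [if_true, Finset.sum_const, Finset.card_univ, Fintype.card_fin]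
    rw [← Nat.cast_smul_eq_nsmul ℝ, smul_smul, smul_smul]
    change ((finrank ℝ E : ℝ) * _) • a = _
    congr 1
    ring
  exact smul_right_injective _ (two_ne_zero (α := ℝ)) e3

variable {F : Type*} [NormedAddCommGroup F] [NormedSpace ℝ F]
  [TopologicalSpace (TotalSpace F V)] [FiberBundle F V] [VectorBundle ℝ F V]
  [ContMDiffVectorBundle ∞ F V I]

theorem contMDiffAt_inner (g : SmoothMetric I M) {x : M} {X Y : Π x : M, TangentSpace I x}
    (hX : CMDiffAt ∞ (T% X) x) (hY : CMDiffAt ∞ (T% Y) x) :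
    CMDiffAt ∞ (fun y ↦ g.inner y (X y) (Y y)) x := by
  have h : ContMDiffAt I (I.prod 𝓘(ℝ)) ∞ (fun y : M ↦ TotalSpace.mk' ℝ
      (E := Bundle.Trivial M ℝ) y (g.inner y (X y) (Y y))) x :=
    ContMDiffAt.clm_bundle_apply₂ (F₁ := E) (F₂ := E) g.contMDiff.contMDiffAt hX hY
  rw [contMDiffAt_totalSpace] at h
  exact h.2

theorem contMDiffAt_det {ι : Type*} [Fintype ι] [DecidableEq ι] {A : M → Matrix ι ι ℝ} {x : M}
    (hA : ∀ i j, CMDiffAt ∞ (fun y ↦ A y i j) x) : CMDiffAt ∞ (fun y ↦ (A y).det) x := by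
  simp only [Matrix.det_apply']
  refine ContMDiffAt.sum fun p _ ↦ contMDiffAt_const.mul ?_
  exact contMDiffAt_finsetProd fun i _ ↦ hA _ _

theorem contMDiffAt_inv_apply {ι : Type*} [Fintype ι] [DecidableEq ι] {A : M → Matrix ι ι ℝ}
    {x : M} (hA : ∀ i j, CMDiffAt ∞ (fun y ↦ A y i j) x) (h0 : (A x).det ≠ 0) (i j : ι) :
    CMDiffAt ∞ (fun y ↦ (A y)⁻¹ i j) x := by
  simp only [Matrix.inv_def, Ring.inverse_eq_inv', Matrix.smul_apply, smul_eq_mul,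
    Matrix.adjugate_apply]
  refine ((contMDiffAt_det hA).inv₀ h0).mul (contMDiffAt_det fun k l ↦ ?_)
  simp only [Matrix.updateRow_apply]
  split_ifs
  · exact contMDiffAt_const
  · exact hA k l

/-- Near each point there is a smooth frame with a smooth metrically dual frame, the latter obtained
from the inverse of the Gram matrix. The Dirac operator is defined by a basis chosen separately in
each tangent space, and this lemma is what makes it preserve smoothness. -/
theorem exists_contMDiffAt_dual_frame (g : SmoothMetric I M) (x₀ : M) :
    ∃ w e : Fin (finrank ℝ E) → Π x : M, TangentSpace I x,
      (∀ i, CMDiffAt ∞ (T% (w i)) x₀) ∧ (∀ i, CMDiffAt ∞ (T% (e i)) x₀) ∧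
      ∀ᶠ x in 𝓝 x₀, ∀ v : TangentSpace I x, ∑ i, g.inner x (w i x) v • e i x = v := by
  set t := trivializationAt E (TangentSpace I) x₀
  have hx₀ : x₀ ∈ t.baseSet := FiberBundle.mem_baseSet_trivializationAt' x₀
  set b := Module.finBasis ℝ E
  set e := t.localFrame b
  have he (i) : CMDiffAt ∞ (T% (e i)) x₀ := contMDiffAt_localFrame_of_mem ∞ t b i hx₀
  let G : M → Matrix (Fin (finrank ℝ E)) (Fin (finrank ℝ E)) ℝ :=
    fun x ↦ Matrix.of fun i j ↦ g.inner x (e i x) (e j x)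
  have hG (i j) : CMDiffAt ∞ (fun x ↦ G x i j) x₀ := contMDiffAt_inner g (he i) (he j)
  -- The Gram matrix is invertible: a vector in its kernel is orthogonal to the whole frame.
  have hdet : ∀ x ∈ t.baseSet, (G x).det ≠ 0 := by
    intro x hx h
    obtain ⟨c, hc, hGc⟩ := Matrix.exists_mulVec_eq_zero_iff.2 h
    refine hc ?_
    have h1 (i) : e i x = t.basisAt b hx i := t.localFrame_apply_of_mem_baseSet b hx
    have h2 : ∑ j, c j • t.basisAt b hx j = 0 := by
      refine eq_of_inner_eq g fun a ↦ ?_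
      rw [map_zero, zero_apply, g.symm]
      have h3 (i) : g.inner x (t.basisAt b hx i) (∑ j, c j • t.basisAt b hx j) = 0 := by
        have := congrFun hGc i
        simp only [Matrix.mulVec, dotProduct, G, Matrix.of_apply, Pi.zero_apply, h1] at this
        simp only [map_sum, map_smul, smul_eq_mul, mul_comm (c _)]
        exact this
      rw [← (t.basisAt b hx).sum_repr a]
      generalize ∑ j, c j • t.basisAt b hx j = y at h3
      simp only [map_sum, map_smul, sum_apply, smul_apply, smul_eq_mul, h3,
        mul_zero, Finset.sum_const_zero]
    exact funext fun j ↦ Fintype.linearIndependent_iff.1 (t.basisAt b hx).linearIndependent c h2 j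
  refine ⟨fun i x ↦ ∑ j, (G x)⁻¹ i j • e j x, e, fun i ↦ ?_, he, ?_⟩
  · exact ContMDiffAt.sum_section fun j _ ↦
      (contMDiffAt_inv_apply hG (hdet x₀ hx₀) i j).smul_section (he j)
  · filter_upwards [t.open_baseSet.mem_nhds hx₀] with x hx v
    have h1 (i) : e i x = t.basisAt b hx i := t.localFrame_apply_of_mem_baseSet b hx
    have h3 (i k) : g.inner x (∑ j, (G x)⁻¹ i j • e j x) (e k x) = if i = k then 1 else 0 := by
      have h4 : ((G x)⁻¹ * G x) i k = (1 : Matrix _ _ ℝ) i k := by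
        rw [Matrix.nonsing_inv_mul _ (isUnit_iff_ne_zero.2 (hdet x hx))]
      rw [Matrix.mul_apply, Matrix.one_apply] at h4
      rw [← h4]
      simp only [map_sum, map_smul, sum_apply, smul_apply, smul_eq_mul]
      rfl
    have h5 (i) : g.inner x (∑ j, (G x)⁻¹ i j • e j x) v = (t.basisAt b hx).repr v i := by
      conv_lhs => rw [← (t.basisAt b hx).sum_repr v]
      rw [map_sum]
      simp only [map_smul, ← h1, h3, smul_eq_mul, mul_ite, mul_one, mul_zero]
      simp
    simp only [h5]
    simp only [h1]
    exact (t.basisAt b hx).sum_repr v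

theorem contMDiffAt_conn {S : DiracData 𝕜 I V}
    (hS : ContMDiffCovariantDerivativeOn F ∞ S.conn Set.univ)
    {σ : Π x : M, V x} (hσ : ContMDiff I (I.prod 𝓘(ℝ, F)) ∞ (fun x ↦ TotalSpace.mk' F x (σ x)))
    {X : Π x : M, TangentSpace I x} {x : M} (hX : CMDiffAt ∞ (T% X) x) :
    CMDiffAt ∞ (T% (fun y ↦ S.conn σ y (X y))) x := by
  have h := hS.contMDiff (σ := σ) (hσ.contMDiffOn)
  have h' := (h x (mem_univ x)).contMDiffAt Filter.univ_mem
  exact ContMDiffAt.clm_bundle_apply (F₁ := E) (F₂ := F) h' hX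

theorem contMDiff_diracOperator {S : DiracData 𝕜 I V} {g : SmoothMetric I M}
    (hconn : ContMDiffCovariantDerivativeOn F ∞ S.conn Set.univ)
    (hcliff : ContMDiff I (I.prod 𝓘(ℝ, E →L[ℝ] F →L[ℝ] F)) ∞
      (fun x ↦ TotalSpace.mk' (E →L[ℝ] F →L[ℝ] F) x (S.cliff x)))
    {σ : Π x : M, V x} (hσ : ContMDiff I (I.prod 𝓘(ℝ, F)) ∞ (fun x ↦ TotalSpace.mk' F x (σ x))) :
    ContMDiff I (I.prod 𝓘(ℝ, F)) ∞ (fun x ↦ TotalSpace.mk' F x (diracOperator S g σ x)) := by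
  intro x₀
  obtain ⟨w, e, hw, he, h⟩ := exists_contMDiffAt_dual_frame g x₀
  have hsum : CMDiffAt ∞ (T% fun x ↦ ∑ i, S.cliff x (w i x) (S.conn σ x (e i x))) x₀ :=
    ContMDiffAt.sum_section fun i _ ↦
      ContMDiffAt.clm_bundle_apply₂ (F₁ := E) (F₂ := F) (F₃ := F) hcliff.contMDiffAt (hw i)
        (contMDiffAt_conn hconn hσ (he i))
  refine hsum.congr_of_eventuallyEq ?_
  filter_upwards [h] with x hx
  exact congrArg (TotalSpace.mk' F x) (diracOperator_eq_sum S g σ hx)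

end DiracOperator

/-! ### The geometry of the warped product -/

section WarpedGeometry

variable {n : ℕ} {t : ℝ} [Fact (0 < t)] {N : Type*} [TopologicalSpace N]
  [ChartedSpace (EuclideanSpace ℝ (Fin n)) N]

theorem du_dslice (u : Icc (0 : ℝ) t) (x : N) (v : TangentSpace (𝓡 n) x) :
    du (u, x) (dslice u x v) = 0 := by
  have h1 : (dslice u x v).1 = 0 := by
    unfold dslice
    rw [mfderiv_prod_right]
    rfl
  rw [du_apply, h1]
  exact map_zero (mvfderiv (𝓡∂ 1) (Subtype.val : Icc (0 : ℝ) t → ℝ) u)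

theorem dprN_dslice (u : Icc (0 : ℝ) t) (x : N) (v : TangentSpace (𝓡 n) x) :
    dprN (u, x) (dslice u x v) = v := by
  rw [dprN_apply]
  unfold dslice
  rw [mfderiv_prod_right]
  rfl

theorem du_ddu (z : Cyl t N) : du z (ddu (n := n) z) = 1 := by
  have h1 : (ddu (n := n) z).1 = (1 : TangentSpace (𝓡∂ 1) z.1) := by
    unfold ddu
    rw [mfderiv_prod_left]
    rfl
  rw [du_apply, h1]
  exact mfderiv_subtypeVal_Icc_one z.1

theorem dprN_ddu (z : Cyl t N) : dprN z (ddu (n := n) z) = 0 := by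
  rw [dprN_apply]
  unfold ddu
  rw [mfderiv_prod_left]
  rfl

theorem tangent_ext {z : Cyl t N} {v w : TangentSpace (cylModel n) z} (h1 : du z v = du z w)
    (h2 : dprN z v = dprN z w) : v = w := by
  rw [dprN_apply, dprN_apply] at h2
  rw [← sub_eq_zero, ← map_sub, du_apply] at h1
  exact Prod.ext (sub_eq_zero.1 (mvfderiv_coe_eq_zero z.1 _ h1)) h2

theorem eq_du_smul_add_dslice (z : Cyl t N) (v : TangentSpace (cylModel n) z) :
    v = du z v • ddu z + dslice z.1 z.2 (dprN z v) := by
  refine tangent_ext ?_ ?_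
  · rw [map_add, map_smul, du_ddu]
    erw [du_dslice]
    simp
  · rw [map_add, map_smul, dprN_ddu]
    erw [dprN_dslice]
    simp

/-- The coordinate `u` of the interval is an affine function of each of the two boundary charts. -/
theorem exists_eq_add_mul_extChartAt_Icc (u : Icc (0 : ℝ) t) : ∃ a ε : ℝ, ∀ v : Icc (0 : ℝ) t,
    (v : ℝ) = a + ε * (extChartAt (𝓡∂ 1) u v : EuclideanSpace ℝ (Fin 1)) 0 := by
  by_cases h : (u : ℝ) < t
  · refine ⟨0, 1, fun v ↦ ?_⟩
    rw [extChartAt, Icc_chartedSpaceChartAt_of_le_top h]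
    change (v : ℝ) = 0 + 1 * (v - 0)
    ring
  · refine ⟨t, -1, fun v ↦ ?_⟩
    rw [extChartAt, Icc_chartedSpaceChartAt_of_top_le (not_lt.1 h)]
    change (v : ℝ) = t + -1 * (t - v)
    ring

variable [IsManifold (𝓡 n) ∞ N]

/-- The extension of a tangent vector at `z` by the field on the cylinder with constant
coordinates in the chart at `z`. -/
abbrev coordField {z : Cyl t N} (v : TangentSpace (cylModel n) z) (y : Cyl t N) :
    TangentSpace (cylModel n) y :=
  FiberBundle.extend (E := fun y : Cyl t N ↦ TangentSpace (cylModel n) y)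
    (EuclideanSpace ℝ (Fin 1) × EuclideanSpace ℝ (Fin n)) v y

/-- `du` is constant on coordinate fields, because `u` is affine in the charts. -/
theorem du_extend {z y : Cyl t N} (v : TangentSpace (cylModel n) z)
    (hy : y ∈ (chartAt (ModelProd (EuclideanHalfSpace 1) (EuclideanSpace ℝ (Fin n))) z).source) :
    du y (coordField v y) = du z v := by
  obtain ⟨a, ε, h⟩ := exists_eq_add_mul_extChartAt_Icc z.1
  let ℓ : EuclideanSpace ℝ (Fin 1) × EuclideanSpace ℝ (Fin n) →L[ℝ] ℝ :=
    ε • (EuclideanSpace.proj 0 ∘L ContinuousLinearMap.fst ℝ _ _)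
  have hf : MDifferentiable (cylModel n) 𝓘(ℝ, ℝ) (fun z : Cyl t N ↦ (z.1 : ℝ)) :=
    (contMDiff_subtypeVal_Icc.comp contMDiff_fst : ContMDiff _ _ 1 _).mdifferentiable one_ne_zero
  have key : ∀ y ∈ (chartAt (ModelProd (EuclideanHalfSpace 1) (EuclideanSpace ℝ (Fin n))) z).source,
      du y (coordField v y) =
        ℓ v := by
    intro y hy
    have hy' : y ∈ (extChartAt (cylModel n) z).source := by rwa [extChartAt_source]
    have hmem := (extChartAt (cylModel n) z).map_source hy'
    refine (mfderiv_extend v hy (hf y)).trans ?_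
    have hpt : ∀ p ∈ (extChartAt (cylModel n) z).target,
        ((fun z : Cyl t N ↦ (z.1 : ℝ)) ∘ (extChartAt (cylModel n) z).symm) p = a + ℓ p := by
      intro p hp
      refine (h ((extChartAt (cylModel n) z).symm p).1).trans ?_
      conv_rhs => rw [← (extChartAt (cylModel n) z).right_inv hp]
      rfl
    have haff : HasFDerivWithinAt ((fun z : Cyl t N ↦ (z.1 : ℝ)) ∘ (extChartAt (cylModel n) z).symm)
        ℓ (range (cylModel n)) (extChartAt (cylModel n) z y) := by
      refine HasFDerivWithinAt.congr_of_eventuallyEq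
        ((ℓ.hasFDerivAt.const_add a).hasFDerivWithinAt) ?_ (hpt _ hmem)
      filter_upwards [extChartAt_target_mem_nhdsWithin_of_mem hmem] using hpt
    rw [mfderivWithin_eq_fderivWithin, haff.fderivWithin
      ((cylModel n).uniqueDiffOn _ (extChartAt_target_subset_range z hmem))]
    rfl
  rw [key y hy, ← key z (mem_chart_source _ z), coordField, FiberBundle.extend_apply_self]

theorem dprN_extend {z y : Cyl t N} (v : TangentSpace (cylModel n) z)
    (hy : y ∈ (chartAt (ModelProd (EuclideanHalfSpace 1) (EuclideanSpace ℝ (Fin n))) z).source) :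
    dprN y (coordField v y) =
      FiberBundle.extend (EuclideanSpace ℝ (Fin n)) (dprN z v) y.2 := by
  have hy2 : y.2 ∈ (chartAt (EuclideanSpace ℝ (Fin n)) z.2).source := hy.2
  have hy2' : y.2 ∈ (extChartAt (𝓡 n) z.2).source := by rwa [extChartAt_source]
  have hy' : y ∈ (extChartAt (cylModel n) z).source := by rwa [extChartAt_source]
  have hmem := (extChartAt (cylModel n) z).map_source hy'
  have hmem2 := (extChartAt (𝓡 n) z.2).map_source hy2'
  refine (mfderiv_extend v hy mdifferentiableAt_snd).trans ?_
  rw [extend_eq_mfderivWithin _ hy2]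
  have hU : UniqueMDiffWithinAt 𝓘(ℝ, EuclideanSpace ℝ (Fin 1) × EuclideanSpace ℝ (Fin n))
      (range (cylModel n)) (extChartAt (cylModel n) z y) :=
    ((cylModel n).uniqueDiffOn _ (extChartAt_target_subset_range z hmem)).uniqueMDiffWithinAt
  have h1 : ∀ p : EuclideanSpace ℝ (Fin 1) × EuclideanSpace ℝ (Fin n),
      ((Prod.snd : Cyl t N → N) ∘ (extChartAt (cylModel n) z).symm) p =
        ((extChartAt (𝓡 n) z.2).symm ∘ Prod.snd) p := fun p ↦ by
    rw [extChartAt_prod]; rfl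
  rw [funext h1, mfderivWithin_comp_of_eq (I' := 𝓘(ℝ, EuclideanSpace ℝ (Fin n)))
    (u := range (𝓡 n)) (mdifferentiableWithinAt_extChartAt_symm hmem2)
    (mdifferentiableAt_iff_differentiableAt.2 differentiableAt_snd).mdifferentiableWithinAt
    (fun p _ ↦ by simp) hU (by rw [extChartAt_prod]; rfl), mfderivWithin_eq_fderivWithin,
    fderivWithin_snd hU.uniqueDiffWithinAt]
  rw [dprN_apply]
  rfl

/-- `∂_u` is itself a coordinate field, up to the orientation of the chart of the interval. -/
theorem ddu_eventuallyEq_extend (z : Cyl t N) : (ddu : Π y : Cyl t N, TangentSpace (cylModel n) y)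
    =ᶠ[𝓝 z] coordField (ddu z) := by
  have h := (chartAt (ModelProd (EuclideanHalfSpace 1) (EuclideanSpace ℝ (Fin n))) z).open_source
  filter_upwards [h.mem_nhds (mem_chart_source _ z)] with y hy
  refine tangent_ext ?_ ?_
  · rw [du_extend _ hy, du_ddu, du_ddu]
  · rw [dprN_extend _ hy, dprN_ddu, dprN_ddu, extend_eq_mfderivWithin _ hy.2]
    exact (map_zero _).symm

theorem contMDiffAt_ddu (z : Cyl t N) :
    ContMDiffAt (cylModel n) (cylModel n).tangent ∞
      (fun y ↦ (⟨y, ddu y⟩ : TangentBundle (cylModel n) (Cyl t N))) z := by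
  refine (FiberBundle.contMDiffAt_extend (cylModel n)
    (EuclideanSpace ℝ (Fin 1) × EuclideanSpace ℝ (Fin n))
    (V := fun y : Cyl t N ↦ TangentSpace (cylModel n) y) (ddu z)).congr_of_eventuallyEq ?_
  filter_upwards [ddu_eventuallyEq_extend (n := n) z] with y hy
  rw [hy]

theorem hasMFDerivAt_comp_coe {f : ℝ → ℝ} {z : Cyl t N}
    (hf : DifferentiableWithinAt ℝ f (Icc 0 t) z.1) :
    HasMFDerivAt (cylModel n) 𝓘(ℝ, ℝ) (fun y : Cyl t N ↦ f y.1) z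
      (derivWithin f (Icc 0 t) z.1 • du z) := by
  have h1 : MDifferentiable (cylModel n) 𝓘(ℝ, ℝ) (fun z : Cyl t N ↦ (z.1 : ℝ)) :=
    (contMDiff_subtypeVal_Icc.comp contMDiff_fst : ContMDiff _ _ 1 _).mdifferentiable one_ne_zero
  have h2 : HasMFDerivWithinAt 𝓘(ℝ, ℝ) 𝓘(ℝ, ℝ) f (Icc 0 t) (z.1 : ℝ) _ :=
    hf.hasDerivWithinAt.hasFDerivWithinAt.hasMFDerivWithinAt
  have h3 := HasMFDerivWithinAt.comp z h2 (h1 z).hasMFDerivAt.hasMFDerivWithinAt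
    (fun y _ ↦ y.1.2 : univ ⊆ _)
  rw [hasMFDerivWithinAt_univ] at h3
  refine h3.congr_mfderiv ?_
  ext v
  exact mul_comm (du z v) (derivWithin f (Icc 0 t) z.1)

theorem mvfderiv_comp_coe {f : ℝ → ℝ} {z : Cyl t N}
    (hf : DifferentiableWithinAt ℝ f (Icc 0 t) z.1) (v : TangentSpace (cylModel n) z) :
    mvfderiv (cylModel n) (fun y : Cyl t N ↦ f y.1) z v =
      derivWithin f (Icc 0 t) z.1 * du z v := by
  unfold mvfderiv
  rw [(hasMFDerivAt_comp_coe hf).mfderiv]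
  rfl

theorem mvfderiv_comp_snd_ddu {f : N → ℝ} {z : Cyl t N}
    (hf : MDifferentiableAt (𝓡 n) 𝓘(ℝ, ℝ) f z.2) :
    mvfderiv (cylModel n) (fun y : Cyl t N ↦ f y.2) z (ddu z) = 0 := by
  have := mvfderiv_comp_apply (I' := cylModel n) (f := (Prod.snd : Cyl t N → N)) z hf
    mdifferentiableAt_snd (ddu z)
  refine this.trans ?_
  rw [show mfderiv (cylModel n) (𝓡 n) (Prod.snd : Cyl t N → N) z (ddu z) = 0 from dprN_ddu z]
  exact map_zero _

theorem mvfderiv_congr_of_eventuallyEq {f h : Cyl t N → ℝ} {z : Cyl t N} (e : f =ᶠ[𝓝 z] h) :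
    mvfderiv (cylModel n) f z = mvfderiv (cylModel n) h z := by
  unfold mvfderiv
  rw [e.mfderiv_eq]
  rfl

theorem warpedMetric_inner (gN : SmoothMetric (𝓡 n) N) (ρ : ℝ → ℝ)
    (hρ : ContDiffOn ℝ ∞ ρ (Icc 0 t)) (hρ0 : ∀ u ∈ Icc 0 t, ρ u ≠ 0) (z : Cyl t N)
    (v w : TangentSpace (cylModel n) z) : (warpedMetric gN ρ hρ hρ0).inner z v w =
      du z v * du z w + (ρ z.1) ^ 2 * gN.inner z.2 (dprN z v) (dprN z w) := rfl

theorem contDiffOn_meanCurvature {ρ : ℝ → ℝ} (hρ : ContDiffOn ℝ ∞ ρ (Icc 0 t))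
    (hρ0 : ∀ u ∈ Icc 0 t, ρ u ≠ 0) : ContDiffOn ℝ ∞ (meanCurvature t ρ) (Icc 0 t) :=
  ((hρ.derivWithin (uniqueDiffOn_Icc (Fact.out : 0 < t)) (by simp)).div hρ hρ0).neg

/-- The three brackets vanish, since all fields are coordinate fields, and so do the derivatives of
`g(∂_u, Z)` and `g(X, ∂_u)`, which are locally constant. What remains is `∂_u (g(X, Z))`. -/
theorem koszul_warpedMetric_ddu (gN : SmoothMetric (𝓡 n) N) (ρ : ℝ → ℝ)
    (hρ : ContDiffOn ℝ ∞ ρ (Icc 0 t)) (hρ0 : ∀ u ∈ Icc 0 t, ρ u ≠ 0) (z : Cyl t N)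
    (X Z : TangentSpace (cylModel n) z) :
    koszul (warpedMetric gN ρ hρ hρ0)
      (coordField X) ddu (coordField Z) z =
      2 * ρ z.1 * derivWithin ρ (Icc 0 t) z.1 * gN.inner z.2 (dprN z X) (dprN z Z) := by
  have hsrc : (chartAt (ModelProd (EuclideanHalfSpace 1) (EuclideanSpace ℝ (Fin n))) z).source ∈
      𝓝 z := (chartAt _ z).open_source.mem_nhds (mem_chart_source _ z)
  have hb1 (X : TangentSpace (cylModel n) z) : VectorField.mlieBracket (cylModel n)
      (coordField X) ddu z = 0 := by
    exact (Filter.EventuallyEq.mlieBracket_vectorField_eq Filter.EventuallyEq.rfl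
      (ddu_eventuallyEq_extend z)).trans (mlieBracket_extend z X (ddu z))
  have hb2 : VectorField.mlieBracket (cylModel n) ddu
      (coordField Z) z = 0 := by
    rw [VectorField.mlieBracket_swap_apply, hb1, neg_zero]
  have hconst {f : Cyl t N → ℝ} {c : ℝ} (hf : f =ᶠ[𝓝 z] fun _ ↦ c) :
      mvfderiv (cylModel n) f z = 0 := by
    rw [mvfderiv_congr_of_eventuallyEq hf, mvfderiv_const]
  have h1 : mvfderiv (cylModel n) (fun y ↦ (warpedMetric gN ρ hρ hρ0).inner y (ddu y)
      (coordField Z y)) z = 0 := by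
    refine hconst (c := du z Z) ?_
    filter_upwards [hsrc] with y hy
    rw [warpedMetric_inner, du_ddu, dprN_ddu, du_extend Z hy]
    simp
  have h2 : mvfderiv (cylModel n) (fun y ↦ (warpedMetric gN ρ hρ hρ0).inner y
      (coordField X y) (ddu y)) z = 0 := by
    refine hconst (c := du z X) ?_
    filter_upwards [hsrc] with y hy
    rw [warpedMetric_inner, du_ddu, dprN_ddu, du_extend X hy]
    simp
  let f : N → ℝ := fun x ↦ gN.inner x
    (FiberBundle.extend (EuclideanSpace ℝ (Fin n)) (dprN z X) x)
    (FiberBundle.extend (EuclideanSpace ℝ (Fin n)) (dprN z Z) x)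
  have hf : MDifferentiableAt (𝓡 n) 𝓘(ℝ, ℝ) f z.2 :=
    mdiffAt_inner gN (FiberBundle.mdifferentiableAt_extend _ _ _)
      (FiberBundle.mdifferentiableAt_extend _ _ _)
  have hρd : DifferentiableWithinAt ℝ ρ (Icc 0 t) z.1 :=
    (hρ z.1 z.1.2).differentiableWithinAt (by simp)
  have hρ2 : DifferentiableWithinAt ℝ (fun u ↦ ρ u ^ 2) (Icc 0 t) z.1 := hρd.pow 2
  have h3 : mvfderiv (cylModel n) (fun y ↦ (warpedMetric gN ρ hρ hρ0).inner y (coordField X y)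
      (coordField Z y)) z (ddu z) =
      2 * ρ z.1 * derivWithin ρ (Icc 0 t) z.1 * gN.inner z.2 (dprN z X) (dprN z Z) := by
    have e : (fun y ↦ (warpedMetric gN ρ hρ hρ0).inner y (coordField X y) (coordField Z y)) =ᶠ[𝓝 z]
        fun y ↦ du z X * du z Z + (ρ y.1 ^ 2) * f y.2 := by
      filter_upwards [hsrc] with y hy
      rw [warpedMetric_inner, du_extend X hy, du_extend Z hy, dprN_extend X hy, dprN_extend Z hy]
    have hm1 := (hasMFDerivAt_comp_coe (N := N) (n := n) hρ2).mdifferentiableAt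
    have hm2 : MDifferentiableAt (cylModel n) 𝓘(ℝ, ℝ) (fun y : Cyl t N ↦ f y.2) z :=
      MDifferentiableAt.comp z hf mdifferentiableAt_snd
    rw [mvfderiv_congr_of_eventuallyEq e, mvfderiv_fun_add
      (g' := fun y : Cyl t N ↦ ρ y.1 ^ 2 * f y.2) mdifferentiableAt_const (hm1.mul hm2),
      mvfderiv_fun_mul hm1 hm2,
      mvfderiv_const]
    simp only [zero_add, add_apply, smul_apply, mvfderiv_comp_snd_ddu hf, mvfderiv_comp_coe hρ2,
      du_ddu, smul_eq_mul, mul_zero, mul_one]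
    rw [derivWithin_fun_pow hρd]
    have hfz : f z.2 = gN.inner z.2 (dprN z X) (dprN z Z) := by simp [f]
    rw [hfz]
    push_cast
    ring
  rw [koszul, h1, h2, hb1, hb2, mlieBracket_extend, h3]
  simp

/-- The shape operator of the slices is a multiple of the identity: `∇_X ∂_u = -H X` for `X` tangent
to a slice, and `∂_u` is parallel along itself. -/
theorem leviCivita_ddu (gN : SmoothMetric (𝓡 n) N) (ρ : ℝ → ℝ)
    (hρ : ContDiffOn ℝ ∞ ρ (Icc 0 t)) (hρ0 : ∀ u ∈ Icc 0 t, ρ u ≠ 0) (z : Cyl t N)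
    (X : TangentSpace (cylModel n) z) :
    leviCivita (warpedMetric gN ρ hρ hρ0) ddu z X =
      -meanCurvature t ρ z.1 • dslice z.1 z.2 (dprN z X) := by
  rw [leviCivita_eq (warpedMetric gN ρ hρ hρ0) ddu z
    (-meanCurvature t ρ z.1 • (dslice z.1 z.2 ∘L dprN z))]
  · rfl
  intro X Z
  rw [koszul_warpedMetric_ddu, warpedMetric_inner, meanCurvature, neg_neg]
  have h0 := hρ0 z.1 z.1.2
  have h1 : du z ((derivWithin ρ (Icc 0 t) z.1 / ρ z.1) • dslice z.1 z.2 (dprN z X)) = 0 := by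
    rw [map_smul]
    erw [du_dslice]
    simp
  have h2 : dprN z ((derivWithin ρ (Icc 0 t) z.1 / ρ z.1) • dslice z.1 z.2 (dprN z X)) =
      (derivWithin ρ (Icc 0 t) z.1 / ρ z.1) • dprN z X := by
    rw [map_smul]
    erw [dprN_dslice]
  rw [smul_apply, ContinuousLinearMap.comp_apply, h1, h2, map_smul, smul_apply, smul_eq_mul]
  field_simp
  ring

end WarpedGeometry

/-! ### The Dirac operators of the cylinder and of its slices -/

section SliceDirac

variable {n : ℕ} {t : ℝ} [Fact (0 < t)] {N : Type*} [TopologicalSpace N]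
  [ChartedSpace (EuclideanSpace ℝ (Fin n)) N] [IsManifold (𝓡 n) ∞ N]
  {𝕜 : Type*} [RCLike 𝕜] {F : Type*} [NormedAddCommGroup F] [NormedSpace ℝ F]
  {V : Cyl t N → Type*} [∀ z, AddCommGroup (V z)] [∀ z, Module ℝ (V z)]
  [∀ z, TopologicalSpace (V z)] [∀ z, IsTopologicalAddGroup (V z)]
  [∀ z, ContinuousSMul ℝ (V z)] [TopologicalSpace (TotalSpace F V)] [FiberBundle F V]
  [VectorBundle ℝ F V]

theorem extendSlice_eventuallyEq (σ : Π z : Cyl t N, V z) (u : Icc (0 : ℝ) t) (x : N) :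
    ∀ᶠ y in 𝓝 x, extendSlice F u (fun y ↦ σ (u, y)) x (u, y) = σ (u, y) := by
  have hb : (u, x) ∈ (trivializationAt F V (u, x)).baseSet :=
    FiberBundle.mem_baseSet_trivializationAt' (u, x)
  have hc : ContinuousAt (fun y : N ↦ ((u, y) : Cyl t N)) x := by fun_prop
  filter_upwards [hc.preimage_mem_nhds ((trivializationAt F V (u, x)).open_baseSet.mem_nhds hb)]
    with y hy
  exact (trivializationAt F V (u, x)).symm_apply_apply_mk hy (σ (u, y))

theorem mdifferentiableAt_extendSlice {σ : Π z : Cyl t N, V z} {u : Icc (0 : ℝ) t} {x : N}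
    (hσ : MDifferentiableAt (cylModel n) ((cylModel n).prod 𝓘(ℝ, F))
      (fun z ↦ TotalSpace.mk' F z (σ z)) (u, x)) :
    MDifferentiableAt (cylModel n) ((cylModel n).prod 𝓘(ℝ, F))
      (fun z ↦ TotalSpace.mk' F z (extendSlice F u (fun y ↦ σ (u, y)) x z)) (u, x) := by
  have h := (mdifferentiableAt_section (cylModel n) σ).1 hσ
  refine (mdifferentiableAt_section (cylModel n) _).2 ?_
  have hj : MDifferentiableAt (cylModel n) (cylModel n)
      (fun z : Cyl t N ↦ ((u, z.2) : Cyl t N)) (u, x) :=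
    mdifferentiableAt_const.prodMk mdifferentiableAt_snd
  have h2 : MDifferentiableAt (cylModel n) 𝓘(ℝ, F)
      ((fun b ↦ (trivializationAt F V (u, x) ⟨b, σ b⟩).2) ∘
        (fun z : Cyl t N ↦ ((u, z.2) : Cyl t N))) (u, x) :=
    MDifferentiableAt.comp (I' := cylModel n) (u, x) h hj
  refine h2.congr_of_eventuallyEq ?_
  have hb : (u, x) ∈ (trivializationAt F V (u, x)).baseSet :=
    FiberBundle.mem_baseSet_trivializationAt' (u, x)
  filter_upwards [(trivializationAt F V (u, x)).open_baseSet.mem_nhds hb] with y hy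
  have e := congrArg Prod.snd ((trivializationAt F V (u, x)).apply_mk_symm hy
    (trivializationAt F V (u, x) ⟨(u, y.2), σ (u, y.2)⟩).2)
  exact e

variable [FiniteDimensional ℝ F] [ContMDiffVectorBundle ∞ F V (cylModel n)]

/-- The extension used in the definition of the connection on the slices does not affect derivatives
in directions tangent to the slice. -/
theorem conn_extendSlice_dslice {S : DiracData 𝕜 (cylModel n) V}
    (hcov : IsCovariantDerivativeOn F S.conn) {σ : Π z : Cyl t N, V z} {u : Icc (0 : ℝ) t} {x : N}
    (hσ : MDifferentiableAt (cylModel n) ((cylModel n).prod 𝓘(ℝ, F))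
      (fun z ↦ TotalSpace.mk' F z (σ z)) (u, x)) (v : TangentSpace (𝓡 n) x) :
    S.conn (extendSlice F u (fun y ↦ σ (u, y)) x) (u, x) (dslice u x v) =
      S.conn σ (u, x) (dslice u x v) :=
  have : ContMDiffVectorBundle 1 F V (cylModel n) := .of_le (n := ∞) (by simp)
  conn_apply_congr_of_comp_eq hcov (f := fun y : N ↦ ((u, y) : Cyl t N))
    (mdifferentiableAt_const.prodMk mdifferentiableAt_id) (mdifferentiableAt_extendSlice hσ) hσ
    (extendSlice_eventuallyEq σ u x) v

theorem mdifferentiableAt_add_add_smul {σ₁ σ₂ σ : Π z : Cyl t N, V z}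
    {z : Cyl t N} {f : ℝ → ℝ}
    (h1 : MDifferentiableAt (cylModel n) ((cylModel n).prod 𝓘(ℝ, F))
      (fun z ↦ TotalSpace.mk' F z (σ₁ z)) z)
    (h2 : MDifferentiableAt (cylModel n) ((cylModel n).prod 𝓘(ℝ, F))
      (fun z ↦ TotalSpace.mk' F z (σ₂ z)) z)
    (hσ : MDifferentiableAt (cylModel n) ((cylModel n).prod 𝓘(ℝ, F))
      (fun z ↦ TotalSpace.mk' F z (σ z)) z)
    (hf : DifferentiableWithinAt ℝ f (Icc 0 t) z.1) :
    MDifferentiableAt (cylModel n) ((cylModel n).prod 𝓘(ℝ, F))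
      (fun z ↦ TotalSpace.mk' F z (σ₁ z + σ₂ z + f z.1 • σ z)) z :=
  mdifferentiableAt_add_section (mdifferentiableAt_add_section h1 h2)
    ((hasMFDerivAt_comp_coe (n := n) (N := N) hf).mdifferentiableAt.smul_section hσ)

theorem conn_add_add_smul {S : DiracData 𝕜 (cylModel n) V}
    (hcov : IsCovariantDerivativeOn F S.conn)
    {σ₁ σ₂ σ : Π z : Cyl t N, V z}
    {z : Cyl t N} {f : ℝ → ℝ}
    (h1 : MDifferentiableAt (cylModel n) ((cylModel n).prod 𝓘(ℝ, F))
      (fun z ↦ TotalSpace.mk' F z (σ₁ z)) z)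
    (h2 : MDifferentiableAt (cylModel n) ((cylModel n).prod 𝓘(ℝ, F))
      (fun z ↦ TotalSpace.mk' F z (σ₂ z)) z)
    (hσ : MDifferentiableAt (cylModel n) ((cylModel n).prod 𝓘(ℝ, F))
      (fun z ↦ TotalSpace.mk' F z (σ z)) z)
    (hf : DifferentiableWithinAt ℝ f (Icc 0 t) z.1) (X : TangentSpace (cylModel n) z) :
    S.conn (fun y ↦ σ₁ y + σ₂ y + f y.1 • σ y) z X =
      S.conn σ₁ z X + S.conn σ₂ z X + f z.1 • S.conn σ z X +
        (derivWithin f (Icc 0 t) z.1 * du z X) • σ z := by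
  have hfd := (hasMFDerivAt_comp_coe (n := n) (N := N) hf).mdifferentiableAt
  have e1 := hcov.add (σ := σ₁ + σ₂) (σ' := (fun y : Cyl t N ↦ f y.1) • σ)
    (mdifferentiableAt_add_section h1 h2) (hfd.smul_section hσ)
  rw [hcov.add h1 h2, hcov.leibniz hσ hfd] at e1
  have e2 := congrArg (fun L ↦ L X) e1
  refine e2.trans ?_
  simp only [add_apply, smul_apply, ContinuousLinearMap.smulRight_apply, mvfderiv_comp_coe hf,
    add_assoc]

/-- The tangential part `∑ γ(eᵢ) ∇_{eᵢ}` of the Dirac operator on the cylinder, where the sum is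
over an orthonormal frame of the slice. -/
def tangentialDirac (S : DiracData 𝕜 (cylModel n) V) (gN : SmoothMetric (𝓡 n) N) (ρ : ℝ → ℝ)
    (hρ0 : ∀ u ∈ Icc 0 t, ρ u ≠ 0) (σ : Π z : Cyl t N, V z) (z : Cyl t N) : V z :=
  ∑ i, S.cliff z (dslice z.1 z.2 (sharp (sliceMetric gN ρ hρ0 z.1) z.2
      ((Module.finBasis ℝ (TangentSpace (𝓡 n) z.2)).coord i)))
    (S.conn σ z (dslice z.1 z.2 (Module.finBasis ℝ (TangentSpace (𝓡 n) z.2) i)))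

variable (gN : SmoothMetric (𝓡 n) N) (ρ : ℝ → ℝ) (hρ : ContDiffOn ℝ ∞ ρ (Icc 0 t))
  (hρ0 : ∀ u ∈ Icc 0 t, ρ u ≠ 0)

/-- The Dirac operator `Q^Z` splits into its normal and tangential parts, by means of a frame that
consists of `∂_u` and a frame of the slice. -/
theorem diracOperator_warpedMetric (S : DiracData 𝕜 (cylModel n) V) (σ : Π z : Cyl t N, V z)
    (z : Cyl t N) :
    diracOperator S (warpedMetric gN ρ hρ hρ0) σ z =
      S.cliff z (ddu z) (nablaU S σ z) + tangentialDirac S gN ρ hρ0 σ z := by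
  obtain ⟨u, x⟩ := z
  set b := Module.finBasis ℝ (TangentSpace (𝓡 n) x) with hb
  rw [diracOperator_eq_sum S (warpedMetric gN ρ hρ hρ0) σ
    (w := fun i : Option (Fin (finrank ℝ (TangentSpace (𝓡 n) x))) ↦ i.elim (ddu (u, x))
      fun i ↦ dslice u x (sharp (sliceMetric gN ρ hρ0 u) x (b.coord i)))
    (e := fun i ↦ i.elim (ddu (u, x)) fun i ↦ dslice u x (b i)), Fintype.sum_option]
  · rfl
  intro v
  rw [Fintype.sum_option]
  simp only [Option.elim]
  have h1 : (warpedMetric gN ρ hρ hρ0).inner (u, x) (ddu (u, x)) v = du (u, x) v := by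
    rw [warpedMetric_inner, du_ddu, dprN_ddu]
    simp
  have h2 (i) : (warpedMetric gN ρ hρ hρ0).inner (u, x)
      (dslice u x (sharp (sliceMetric gN ρ hρ0 u) x (b.coord i))) v =
      (sliceMetric gN ρ hρ0 u).inner x (sharp (sliceMetric gN ρ hρ0 u) x (b.coord i))
        (dprN (u, x) v) := by
    rw [warpedMetric_inner, du_dslice, dprN_dslice, zero_mul, zero_add]
    rfl
  simp only [h1, h2]
  conv_rhs => rw [eq_du_smul_add_dslice (u, x) v]
  congr 1
  simp only [← map_smul, ← map_sum]
  exact congrArg _ (sum_inner_sharp_smul (sliceMetric gN ρ hρ0 u) x (dprN (u, x) v))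

variable {gN ρ hρ hρ0} [∀ z, Module 𝕜 (V z)] {S : DiracData 𝕜 (cylModel n) V}
  (hS : S.IsDiracBundle F (warpedMetric gN ρ hρ hρ0))

include hS

theorem cliff_ddu_cliff_ddu (z : Cyl t N) (a : V z) :
    S.cliff z (ddu z) (S.cliff z (ddu z) a) = -a := by
  rw [hS.cliff_sq, warpedMetric_inner, du_ddu, dprN_ddu]
  simp

theorem cliff_dslice_cliff_ddu (u : Icc (0 : ℝ) t) (x : N) (v : TangentSpace (𝓡 n) x)
    (a : V (u, x)) :
    S.cliff (u, x) (dslice u x v) (S.cliff (u, x) (ddu (u, x)) a) =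
      -S.cliff (u, x) (ddu (u, x)) (S.cliff (u, x) (dslice u x v) a) := by
  have h := cliff_anticomm S (warpedMetric gN ρ hρ hρ0) (hS.cliff_sq (u, x))
    (dslice u x v) (ddu (u, x)) a
  rw [warpedMetric_inner, du_dslice, dprN_ddu] at h
  rw [eq_neg_iff_add_eq_zero, h]
  simp

theorem sliceData_cliff_sliceData_cliff (u : Icc (0 : ℝ) t) (x : N) (v w : TangentSpace (𝓡 n) x)
    (a : V (u, x)) :
    (sliceData F S (warpedMetric gN ρ hρ hρ0) u).cliff x v
        ((sliceData F S (warpedMetric gN ρ hρ hρ0) u).cliff x w a) =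
      S.cliff (u, x) (dslice u x v) (S.cliff (u, x) (dslice u x w) a) := by
  change -S.cliff (u, x) (ddu (u, x)) (S.cliff (u, x) (dslice u x v)
    (-S.cliff (u, x) (ddu (u, x)) (S.cliff (u, x) (dslice u x w) a))) = _
  rw [map_neg, cliff_dslice_cliff_ddu hS, neg_neg, cliff_ddu_cliff_ddu hS, neg_neg]

theorem sliceData_cliff_sq (u : Icc (0 : ℝ) t) (x : N) (v : TangentSpace (𝓡 n) x)
    (a : V (u, x)) :
    (sliceData F S (warpedMetric gN ρ hρ hρ0) u).cliff x v
        ((sliceData F S (warpedMetric gN ρ hρ hρ0) u).cliff x v a) =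
      -((sliceMetric gN ρ hρ0 u).inner x v v) • a := by
  rw [sliceData_cliff_sliceData_cliff hS, hS.cliff_sq, sliceMetric_eq gN ρ hρ hρ0]

theorem sum_cliff_dslice_sharp_cliff_dslice (u : Icc (0 : ℝ) t) (x : N) (a : V (u, x)) :
    ∑ i, S.cliff (u, x) (dslice u x (sharp (sliceMetric gN ρ hρ0 u) x
      ((Module.finBasis ℝ (TangentSpace (𝓡 n) x)).coord i)))
      (S.cliff (u, x) (dslice u x (Module.finBasis ℝ (TangentSpace (𝓡 n) x) i)) a) =
      -(n : ℝ) • a := by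
  have h := sum_cliff_sharp_cliff (sliceData F S (warpedMetric gN ρ hρ hρ0) u)
    (sliceMetric gN ρ hρ0 u) (sliceData_cliff_sq hS u x) a
  simp only [sliceData_cliff_sliceData_cliff hS, finrank_euclideanSpace_fin] at h
  exact h

/-- As `∇^g_X ν = -H X`, the connection of the slice differs from `∇^Z` by a multiple of `γ_N(X)`;
summed over a frame of the slice, this difference gives the term in `H`. -/
theorem sliceDirac_eq_tangentialDirac {σ : Π z : Cyl t N, V z} {z : Cyl t N}
    (hσ : MDifferentiableAt (cylModel n) ((cylModel n).prod 𝓘(ℝ, F))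
      (fun z ↦ TotalSpace.mk' F z (σ z)) z) :
    sliceDirac F S gN ρ hρ hρ0 σ z = -S.cliff z (ddu z) (tangentialDirac S gN ρ hρ0 σ z) +
      (n / 2 * meanCurvature t ρ z.1) • σ z := by
  obtain ⟨u, x⟩ := z
  set g := warpedMetric gN ρ hρ hρ0
  have hconn (v : TangentSpace (𝓡 n) x) :
      (sliceData F S g u).conn (fun y ↦ σ (u, y)) x v = S.conn σ (u, x) (dslice u x v) -
        (1 / 2 * meanCurvature t ρ u) • (sliceData F S g u).cliff x v (σ (u, x)) := by
    change S.conn (extendSlice F u (fun y ↦ σ (u, y)) x) (u, x) (dslice u x v) -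
      (1 / 2 : ℝ) • S.cliff (u, x) (ddu (u, x)) (S.cliff (u, x)
        (leviCivita g ddu (u, x) (dslice u x v)) (σ (u, x))) = _ -
      (1 / 2 * meanCurvature t ρ u) • -(S.cliff (u, x) (ddu (u, x)) (S.cliff (u, x) (dslice u x v)
        (σ (u, x))))
    rw [conn_extendSlice_dslice hS.conn_cov hσ, leviCivita_ddu, dprN_dslice]
    simp only [map_smul, smul_apply]
    module
  have hsum : sliceDirac F S gN ρ hρ hρ0 σ (u, x) =
      ∑ i, (sliceData F S g u).cliff x (sharp (sliceMetric gN ρ hρ0 u) x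
        ((Module.finBasis ℝ (TangentSpace (𝓡 n) x)).coord i))
        ((sliceData F S g u).conn (fun y ↦ σ (u, y)) x
          (Module.finBasis ℝ (TangentSpace (𝓡 n) x) i)) := rfl
  rw [hsum]
  simp only [hconn, map_sub, map_smul, Finset.sum_sub_distrib, ← Finset.smul_sum]
  rw [sum_cliff_sharp_cliff (sliceData F S g u) (sliceMetric gN ρ hρ0 u)
    (sliceData_cliff_sq hS u x), finrank_euclideanSpace_fin]
  have h1 : ∑ i, (sliceData F S g u).cliff x (sharp (sliceMetric gN ρ hρ0 u) x
        ((Module.finBasis ℝ (TangentSpace (𝓡 n) x)).coord i))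
        (S.conn σ (u, x) (dslice u x (Module.finBasis ℝ (TangentSpace (𝓡 n) x) i))) =
      -S.cliff (u, x) (ddu (u, x)) (tangentialDirac S gN ρ hρ0 σ (u, x)) := by
    rw [tangentialDirac, map_sum, ← Finset.sum_neg_distrib]
    rfl
  rw [h1]
  module

theorem conn_cliff_ddu {τ : Π z : Cyl t N, V z} {z : Cyl t N}
    (hτ : MDifferentiableAt (cylModel n) ((cylModel n).prod 𝓘(ℝ, F))
      (fun z ↦ TotalSpace.mk' F z (τ z)) z) (X : TangentSpace (cylModel n) z) :
    S.conn (fun y ↦ S.cliff y (ddu y) (τ y)) z X =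
      -meanCurvature t ρ z.1 • S.cliff z (dslice z.1 z.2 (dprN z X)) (τ z) +
        S.cliff z (ddu z) (S.conn τ z X) := by
  rw [hS.conn_cliff z ddu τ ((contMDiffAt_ddu z).mdifferentiableAt (by simp)) hτ X,
    leviCivita_ddu, map_smul, smul_apply]

theorem nablaU_cliff_ddu {τ : Π z : Cyl t N, V z} {z : Cyl t N}
    (hτ : MDifferentiableAt (cylModel n) ((cylModel n).prod 𝓘(ℝ, F))
      (fun z ↦ TotalSpace.mk' F z (τ z)) z) :
    nablaU S (fun y ↦ S.cliff y (ddu y) (τ y)) z = S.cliff z (ddu z) (nablaU S τ z) := by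
  rw [nablaU, conn_cliff_ddu hS hτ, dprN_ddu, map_zero, map_zero, zero_apply, smul_zero, zero_add]
  rfl

theorem tangentialDirac_cliff_ddu {τ : Π z : Cyl t N, V z} {z : Cyl t N}
    (hτ : MDifferentiableAt (cylModel n) ((cylModel n).prod 𝓘(ℝ, F))
      (fun z ↦ TotalSpace.mk' F z (τ z)) z) :
    tangentialDirac S gN ρ hρ0 (fun y ↦ S.cliff y (ddu y) (τ y)) z =
      (n * meanCurvature t ρ z.1) • τ z -
        S.cliff z (ddu z) (tangentialDirac S gN ρ hρ0 τ z) := by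
  obtain ⟨u, x⟩ := z
  have hc (v : TangentSpace (𝓡 n) x) :
      S.conn (fun y ↦ S.cliff y (ddu y) (τ y)) (u, x) (dslice u x v) =
        -meanCurvature t ρ u • S.cliff (u, x) (dslice u x v) (τ (u, x)) +
          S.cliff (u, x) (ddu (u, x)) (S.conn τ (u, x) (dslice u x v)) := by
    rw [conn_cliff_ddu hS hτ, dprN_dslice]
  simp only [tangentialDirac, hc, map_add, map_smul, cliff_dslice_cliff_ddu hS,
    Finset.sum_add_distrib, ← Finset.smul_sum, map_sum, Finset.sum_neg_distrib]
  rw [sum_cliff_dslice_sharp_cliff_dslice hS]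
  module

/-- `Q^Z = γ(ν) (∇_ν + Q^N - (n/2) H)`, where `n = m - 1` is the dimension of the slices. -/
theorem diracOperator_eq_cliff_ddu {σ : Π z : Cyl t N, V z} {z : Cyl t N}
    (hσ : MDifferentiableAt (cylModel n) ((cylModel n).prod 𝓘(ℝ, F))
      (fun z ↦ TotalSpace.mk' F z (σ z)) z) :
    diracOperator S (warpedMetric gN ρ hρ hρ0) σ z = S.cliff z (ddu z)
      (nablaU S σ z + sliceDirac F S gN ρ hρ hρ0 σ z +
        (-(n / 2 * meanCurvature t ρ z.1)) • σ z) := by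
  rw [diracOperator_warpedMetric, sliceDirac_eq_tangentialDirac hS hσ]
  simp only [map_add, map_neg, cliff_ddu_cliff_ddu hS, neg_smul]
  abel

/-- `Q^Z γ(ν) = -∇_ν + Q^N + (n/2) H`. Compared with `diracOperator_eq_cliff_ddu`, the potential
has the opposite sign; this comes from the terms `γ(eᵢ) γ(∇_{eᵢ} ν)`, whose sum is `n H`. -/
theorem diracOperator_cliff_ddu {τ : Π z : Cyl t N, V z} {z : Cyl t N}
    (hτ : MDifferentiableAt (cylModel n) ((cylModel n).prod 𝓘(ℝ, F))
      (fun z ↦ TotalSpace.mk' F z (τ z)) z) :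
    diracOperator S (warpedMetric gN ρ hρ hρ0) (fun y ↦ S.cliff y (ddu y) (τ y)) z =
      -nablaU S τ z + sliceDirac F S gN ρ hρ hρ0 τ z +
        (n / 2 * meanCurvature t ρ z.1) • τ z := by
  rw [diracOperator_warpedMetric, nablaU_cliff_ddu hS hτ, tangentialDirac_cliff_ddu hS hτ,
    sliceDirac_eq_tangentialDirac hS hτ, cliff_ddu_cliff_ddu hS]
  module

theorem contMDiff_nablaU {σ : Π z : Cyl t N, V z}
    (hσ : ContMDiff (cylModel n) ((cylModel n).prod 𝓘(ℝ, F)) ∞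
      (fun z ↦ TotalSpace.mk' F z (σ z))) :
    ContMDiff (cylModel n) ((cylModel n).prod 𝓘(ℝ, F)) ∞
      (fun z ↦ TotalSpace.mk' F z (nablaU S σ z)) :=
  fun z ↦ contMDiffAt_conn hS.conn_smooth hσ (contMDiffAt_ddu z)

/-- The operator `Q^N` expressed by operators on the cylinder. This shows that `Q^N σ`, which is
defined slice by slice, is regular in the direction of `u` as well. -/
theorem sliceDirac_eq_sub_cliff_ddu_diracOperator {σ : Π z : Cyl t N, V z} {z : Cyl t N}
    (hσ : MDifferentiableAt (cylModel n) ((cylModel n).prod 𝓘(ℝ, F))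
      (fun z ↦ TotalSpace.mk' F z (σ z)) z) :
    sliceDirac F S gN ρ hρ hρ0 σ z = (n / 2 * meanCurvature t ρ z.1) • σ z - nablaU S σ z -
      S.cliff z (ddu z) (diracOperator S (warpedMetric gN ρ hρ hρ0) σ z) := by
  rw [diracOperator_eq_cliff_ddu hS hσ, cliff_ddu_cliff_ddu hS]
  module

theorem mdifferentiableAt_sliceDirac {σ : Π z : Cyl t N, V z}
    (hσ : ContMDiff (cylModel n) ((cylModel n).prod 𝓘(ℝ, F)) ∞
      (fun z ↦ TotalSpace.mk' F z (σ z))) (z : Cyl t N) :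
    MDifferentiableAt (cylModel n) ((cylModel n).prod 𝓘(ℝ, F))
      (fun z ↦ TotalSpace.mk' F z (sliceDirac F S gN ρ hρ hρ0 σ z)) z := by
  have hσd (z) := (hσ z).mdifferentiableAt (by simp)
  have hH := (contDiffOn_meanCurvature hρ hρ0 z.1 z.1.2).differentiableWithinAt (by simp)
  have h1 := (hasMFDerivAt_comp_coe (n := n) (N := N) (z := z)
    (hH.const_mul (n / 2 : ℝ))).mdifferentiableAt
  have h2 : MDifferentiableAt (cylModel n) ((cylModel n).prod 𝓘(ℝ, F)) (fun z ↦ TotalSpace.mk' F z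
      (S.cliff z (ddu z) (diracOperator S (warpedMetric gN ρ hρ hρ0) σ z))) z :=
    (ContMDiffAt.clm_bundle_apply₂ (F₁ := EuclideanSpace ℝ (Fin 1) × EuclideanSpace ℝ (Fin n))
      (F₂ := F) (F₃ := F) hS.cliff_smooth.contMDiffAt (contMDiffAt_ddu z)
      (contMDiff_diracOperator hS.conn_smooth hS.cliff_smooth hσ z)).mdifferentiableAt (by simp)
  have h3 := mdifferentiableAt_sub_section (mdifferentiableAt_sub_section (h1.smul_section (hσd z))
    ((contMDiff_nablaU hS hσ z).mdifferentiableAt (by simp))) h2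
  refine h3.congr_of_eventuallyEq (Filter.Eventually.of_forall fun y ↦ ?_)
  exact congrArg (TotalSpace.mk' F y) (sliceDirac_eq_sub_cliff_ddu_diracOperator hS (hσd y))

theorem sliceDirac_add_add_smul {σ₁ σ₂ σ : Π z : Cyl t N, V z}
    {z : Cyl t N} {f : ℝ → ℝ}
    (h1 : MDifferentiableAt (cylModel n) ((cylModel n).prod 𝓘(ℝ, F))
      (fun z ↦ TotalSpace.mk' F z (σ₁ z)) z)
    (h2 : MDifferentiableAt (cylModel n) ((cylModel n).prod 𝓘(ℝ, F))
      (fun z ↦ TotalSpace.mk' F z (σ₂ z)) z)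
    (hσ : MDifferentiableAt (cylModel n) ((cylModel n).prod 𝓘(ℝ, F))
      (fun z ↦ TotalSpace.mk' F z (σ z)) z)
    (hf : DifferentiableWithinAt ℝ f (Icc 0 t) z.1) :
    sliceDirac F S gN ρ hρ hρ0 (fun y ↦ σ₁ y + σ₂ y + f y.1 • σ y) z =
      sliceDirac F S gN ρ hρ hρ0 σ₁ z + sliceDirac F S gN ρ hρ hρ0 σ₂ z +
        f z.1 • sliceDirac F S gN ρ hρ hρ0 σ z := by
  obtain ⟨u, x⟩ := z
  rw [sliceDirac_eq_tangentialDirac hS (mdifferentiableAt_add_add_smul h1 h2 hσ hf),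
    sliceDirac_eq_tangentialDirac hS h1, sliceDirac_eq_tangentialDirac hS h2,
    sliceDirac_eq_tangentialDirac hS hσ]
  have hT : tangentialDirac S gN ρ hρ0 (fun y ↦ σ₁ y + σ₂ y + f y.1 • σ y) (u, x) =
      tangentialDirac S gN ρ hρ0 σ₁ (u, x) + tangentialDirac S gN ρ hρ0 σ₂ (u, x) +
        f u • tangentialDirac S gN ρ hρ0 σ (u, x) := by
    have hc (v : TangentSpace (𝓡 n) x) :
        S.conn (fun y ↦ σ₁ y + σ₂ y + f y.1 • σ y) (u, x) (dslice u x v) =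
          S.conn σ₁ (u, x) (dslice u x v) + S.conn σ₂ (u, x) (dslice u x v) +
            f u • S.conn σ (u, x) (dslice u x v) := by
      rw [conn_add_add_smul hS.conn_cov h1 h2 hσ hf, du_dslice, mul_zero, zero_smul, add_zero]
    simp only [tangentialDirac, hc, map_add, map_smul, Finset.sum_add_distrib, ← Finset.smul_sum]
  rw [hT]
  simp only [map_add, map_smul]
  module

theorem nablaU_add_add_smul {σ₁ σ₂ σ : Π z : Cyl t N, V z}
    {z : Cyl t N} {f : ℝ → ℝ}
    (h1 : MDifferentiableAt (cylModel n) ((cylModel n).prod 𝓘(ℝ, F))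
      (fun z ↦ TotalSpace.mk' F z (σ₁ z)) z)
    (h2 : MDifferentiableAt (cylModel n) ((cylModel n).prod 𝓘(ℝ, F))
      (fun z ↦ TotalSpace.mk' F z (σ₂ z)) z)
    (hσ : MDifferentiableAt (cylModel n) ((cylModel n).prod 𝓘(ℝ, F))
      (fun z ↦ TotalSpace.mk' F z (σ z)) z)
    (hf : DifferentiableWithinAt ℝ f (Icc 0 t) z.1) :
    nablaU S (fun y ↦ σ₁ y + σ₂ y + f y.1 • σ y) z =
      nablaU S σ₁ z + nablaU S σ₂ z + f z.1 • nablaU S σ z +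
        derivWithin f (Icc 0 t) z.1 • σ z := by
  rw [nablaU, conn_add_add_smul hS.conn_cov h1 h2 hσ hf, du_ddu, mul_one]
  rfl

end SliceDirac

end DiracGeometry

/-! ### The formula for the Dirac Laplacian -/

theorem mainTheorem7 {𝕜 : Type*} [RCLike 𝕜] {m n : ℕ} (hm : m = n + 1)
    {N : Type*} [TopologicalSpace N] [T2Space N] [SecondCountableTopology N]
    [ChartedSpace (EuclideanSpace ℝ (Fin n)) N] [IsManifold (𝓡 n) ∞ N]
    (gN : DiracGeometry.SmoothMetric (𝓡 n) N)
    (t : ℝ) [Fact (0 < t)] (ρ : ℝ → ℝ) (hρ : ContDiffOn ℝ ∞ ρ (Icc 0 t))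
    (hρ0 : ∀ u ∈ Icc 0 t, ρ u ≠ 0)
    (F : Type*) [NormedAddCommGroup F] [NormedSpace ℝ F] [FiniteDimensional ℝ F]
    [NormedSpace 𝕜 F] [IsScalarTower ℝ 𝕜 F]
    (V : DiracGeometry.Cyl t N → Type*) [∀ z, AddCommGroup (V z)] [∀ z, Module ℝ (V z)]
    [∀ z, Module 𝕜 (V z)] [∀ z, IsScalarTower ℝ 𝕜 (V z)]
    [∀ z, TopologicalSpace (V z)] [∀ z, IsTopologicalAddGroup (V z)]
    [∀ z, ContinuousSMul ℝ (V z)] [TopologicalSpace (TotalSpace F V)] [FiberBundle F V]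
    [VectorBundle ℝ F V] [VectorBundle 𝕜 F V]
    [ContMDiffVectorBundle ∞ F V (DiracGeometry.cylModel n)]
    (S : DiracGeometry.DiracData 𝕜 (DiracGeometry.cylModel n) V)
    (hS : S.IsDiracBundle F (DiracGeometry.warpedMetric gN ρ hρ hρ0))
    (σ : Π z : DiracGeometry.Cyl t N, V z)
    (hσ : ContMDiff (DiracGeometry.cylModel n) ((DiracGeometry.cylModel n).prod 𝓘(ℝ, F)) ∞
      (fun z ↦ TotalSpace.mk' F z (σ z)))
    (z : DiracGeometry.Cyl t N) :
    letI Q := DiracGeometry.sliceDirac F S gN ρ hρ hρ0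
    letI D := DiracGeometry.nablaU S
    letI H := DiracGeometry.meanCurvature t ρ
    letI H' := derivWithin H (Icc 0 t)
    letI c : ℝ := ((m : ℝ) - 1) / 2
    DiracGeometry.diracLaplacian S (DiracGeometry.warpedMetric gN ρ hρ hρ0) σ z =
      DiracGeometry.sliceLaplacian F S gN ρ hρ hρ0 σ z
        + (Q (D σ) z - D (Q σ) z)
        + (c * H' z.1 - c ^ 2 * H z.1 ^ 2) • σ z
        + (((m : ℝ) - 1) * H z.1) • D σ z
        - D (D σ) z := by
  subst hm
  set Q := DiracGeometry.sliceDirac F S gN ρ hρ hρ0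
  set D := DiracGeometry.nablaU S
  set H := DiracGeometry.meanCurvature t ρ
  set H' := derivWithin H (Icc 0 t)
  let f : ℝ → ℝ := fun u ↦ -(n / 2 * H u)
  have hσd (z) := (hσ z).mdifferentiableAt (by simp)
  have hD (z) := (DiracGeometry.contMDiff_nablaU hS hσ z).mdifferentiableAt (by simp)
  have hQ (z) := DiracGeometry.mdifferentiableAt_sliceDirac hS hσ z
  have hH (u : Icc (0 : ℝ) t) : DifferentiableWithinAt ℝ H (Icc 0 t) u :=
    (DiracGeometry.contDiffOn_meanCurvature hρ hρ0 u u.2).differentiableWithinAt (by simp)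
  have hf (u : Icc (0 : ℝ) t) : DifferentiableWithinAt ℝ f (Icc 0 t) u :=
    ((hH u).const_mul (n / 2 : ℝ)).neg
  have hf' : derivWithin f (Icc 0 t) z.1 = -(n / 2 * H' z.1) :=
     (((hH z.1).hasDerivWithinAt.const_mul (n / 2 : ℝ)).neg).derivWithin
      (uniqueDiffOn_Icc (Fact.out : 0 < t) _ z.1.2)
  -- `Q^Z σ = γ(ν) τ`, so that `P^Z σ = Q^Z (γ(ν) τ)`.
  set τ : Π z : DiracGeometry.Cyl t N, V z := fun y ↦ D σ y + Q σ y + f y.1 • σ y with hτdef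
  have hK : DiracGeometry.diracOperator S (DiracGeometry.warpedMetric gN ρ hρ hρ0) σ =
      fun y ↦ S.cliff y (DiracGeometry.ddu y) (τ y) :=
    funext fun y ↦ DiracGeometry.diracOperator_eq_cliff_ddu hS (hσd y)
  have hτ : MDifferentiableAt _ _ (fun z ↦ TotalSpace.mk' F z (τ z)) z :=
    DiracGeometry.mdifferentiableAt_add_add_smul (hD z) (hQ z) (hσd z) (hf z.1)
  have hDτ : D τ z = D (D σ) z + D (Q σ) z + f z.1 • D σ z +
      derivWithin f (Icc 0 t) z.1 • σ z :=
    DiracGeometry.nablaU_add_add_smul hS (hD z) (hQ z) (hσd z) (hf z.1)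
  have hQτ : Q τ z = Q (D σ) z + Q (Q σ) z + f z.1 • Q σ z :=
    DiracGeometry.sliceDirac_add_add_smul hS (hD z) (hQ z) (hσd z) (hf z.1)
  have hmain : DiracGeometry.diracOperator S (DiracGeometry.warpedMetric gN ρ hρ hρ0)
      (fun y ↦ S.cliff y (DiracGeometry.ddu y) (τ y)) z =
      -D τ z + Q τ z + (n / 2 * H z.1) • τ z :=
    DiracGeometry.diracOperator_cliff_ddu hS hτ
  have hP : DiracGeometry.sliceLaplacian F S gN ρ hρ hρ0 σ z = Q (Q σ) z := rfl
  rw [DiracGeometry.diracLaplacian, hK, hmain, hDτ, hQτ, hf', hP, hτdef]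
  simp only [f]
  push_cast
  module
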